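/- **Setting.** Let $\Theta\subset\mathbb{R}^p$ and $\mathcal{S}\subset\mathbb{R}^q$ be open, $\theta_0\in\Theta$, and for each $N\in\mathbb{N}$ let $(\mathbf{P}^{(N)}_\theta)_{\theta\in\Theta}$ be probability measures on a measurable space $\mathscr{X}^{(N)}$, with observation $x^N$, and let $D_N$ be a non-degenerate $p\times p$ matrix. For each $N$ let $\Pi_N(d\theta|x)$ (the quasi-posterior) be a probability kernel from $\mathscr{X}^{(N)}$ to $\Theta$, $Q_N(\theta,d\vartheta|x)$ (the proposal) a probability kernel from $\mathscr{X}^{(N)}\times\Theta$ to $\Theta$, and $A_N(\theta,\vartheta|x)\in[0,1]$ a measurable function such that for every $x\in\mathscr{X}^{(N)}$, as measures on $\Theta^2$, $$\Pi_N(d\theta|x)Q_N(\theta,d\vartheta|x)A_N(\theta,\vartheta|x)=\Pi_N(d\vartheta|x)Q_N(\vartheta,d\theta|x)A_N(\vartheta,\theta|x).$$ Given $x^N=x$, let $\theta^N_0,\theta^N_1,\dots$ be the Markov chain with $\theta^N_0\sim\Pi_N(\cdot|x)$ and transition kernel $$P_N(\theta,d\vartheta|x)=Q_N(\theta,d\vartheta|x)A_N(\theta,\vartheta|x)+R_N(\theta|x)\,\delta_\theta(d\vartheta),\qquad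 R_N(\theta|x)=1-\int Q_N(\theta,d\vartheta|x)A_N(\theta,\vartheta|x),$$ and let $F^N_M=\frac1M\sum_{m=0}^{M-1}\delta_{\theta^N_m}$. For a measure $F$ on $\Theta$, $F(\theta_0+D_N^{-1}du)$ denotes its image under $\theta\mapsto u=D_N(\theta-\theta_0)$; similarly for pairs. Put $\|\mu-\nu\|_{\mathrm{TV}}=\sup_{|f|\le1}|\int f\,d\mu-\int f\,d\nu|$ over measurable $f$, and let $\|\mu-\nu\|_{\mathrm{BL}}$ be the same supremum over measurable $f$ with $|f|\le 1$ and $|f(x)-f(y)|\le\|x-y\|$. For $s\in\mathcal{S}$ let $\Pi(du|s)=\pi(u|s)\,du$ and $Q(u,dv|s)=q(u,v|s)\,dv$ be probability kernels with jointly measurable densities, let $A(u,v|s)\in[0,1]$ be jointly measurable, and put $$P(u,dv|s)=Q(u,dv|s)A(u,v|s)+R(u|s)\,\delta_u(dv),\qquad R(u|s)=1-\int Q(u,dv|s)A(u,v|s).$$ Let $s_N:\mathscr{X}^{(N)}\to\mathcal{S}$ be measurable. **Proposition.** Suppose that 1. for each $s\in\mathcal{S}$, the kernel $P(u,dv|s)$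 is ergodic, i.e. irreducible and positive recurrent, with invariant probability measure $\Pi(du|s)$; 2. the laws of $s_N$ under $\mathbf{P}^{(N)}_{\theta_0}$, $N\in\mathbb{N}$, are tight in $\mathcal{S}$; 3. for each $u,v\in\mathbb{R}^p$ the functions $\pi(u|s)$, $q(u,v|s)$, $A(u,v|s)$ are continuous in $s$, and $\sup_{s\in K}\sup_{u,v\in\mathbb{R}^p}\{\pi(u|s)+q(u,v|s)\}<\infty$ for every compact $K\subset\mathcal{S}$; 4. for each $u,v\in\mathbb{R}^p$, $A_N(\theta_0+D_N^{-1}u,\theta_0+D_N^{-1}v|x^N)-A(u,v|s_N)\to0$ in $\mathbf{P}^{(N)}_{\theta_0}$-probability as $N\to\infty$ (the difference being read as $0$ for those $N$ for which $\theta_0+D_N^{-1}u$ or $\theta_0+D_N^{-1}v$ is not in $\Theta$); 5. $\big\|\Pi_N(\theta_0+D_N^{-1}du|x^N)\,Q_N(\theta_0+D_N^{-1}u,\theta_0+D_N^{-1}dv|x^N)-\Pi(du|s_N)\,Q(u,dv|s_N)\big\|_{\mathrm{TV}}\to0$ in $\mathbf{P}^{(N)}_{\theta_0}$-probability as $N\to\infty$.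 Then the family of Markov chain Monte Carlo methods is locally consistent at $\theta_0$: as $N,M\to\infty$, $$\big\|\Pi_N(\theta_0+D_N^{-1}du|x^N)-F^N_M(\theta_0+D_N^{-1}du)\big\|_{\mathrm{BL}}\to0$$ in probability, under the joint law of $x^N\sim\mathbf{P}^{(N)}_{\theta_0}$ and of the chain generated from $x^N$. -/

import Mathlib

open MeasureTheory ProbabilityTheory Filter Topology
open scoped ENNReal NNReal

noncomputable section

/-! ### Distances between measures and convergence in probability -/

/-- The total variation distance `sup_{|f| ≤ 1} |∫ f dμ - ∫ f dν|`, over measurable `f`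
(used for probability measures). -/
def tvDist {E : Type*} [MeasurableSpace E] (μ ν : Measure E) : ℝ :=
  ⨆ f : {f : E → ℝ // Measurable f ∧ ∀ x, |f x| ≤ 1}, |∫ x, f.1 x ∂μ - ∫ x, f.1 x ∂ν|

/-- The bounded Lipschitz distance: the supremum of `|∫ f dμ - ∫ f dν|` over measurable `f` with
`|f| ≤ 1` and `|f x - f y| ≤ ‖x - y‖` (used for probability measures). -/
def blDist {E : Type*} [NormedAddCommGroup E] [MeasurableSpace E] (μ ν : Measure E) : ℝ :=
  ⨆ f : {f : E → ℝ // Measurable f ∧ (∀ x, |f x| ≤ 1) ∧ ∀ x y, |f x - f y| ≤ ‖x - y‖},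
    |∫ x, f.1 x ∂μ - ∫ x, f.1 x ∂ν|

/-- `Y i → 0` in `μ i`-probability along the filter `l`; the probability space may depend
on the index. -/
def TendstoZeroInProb {ι : Type*} {Ω : ι → Type*} [∀ i, MeasurableSpace (Ω i)]
    (l : Filter ι) (μ : ∀ i, Measure (Ω i)) (Y : ∀ i, Ω i → ℝ) : Prop :=
  ∀ ε : ℝ, 0 < ε → Tendsto (fun i => μ i {ω | ε ≤ |Y i ω|}) l (𝓝 0)

/-! ### Metropolis--Hastings kernels -/

section Metropolis

variable {α β : Type*} [MeasurableSpace α] [MeasurableSpace β]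

/-- With a parameter `a : α`, the kernel
`P(θ, dϑ | a) = Q(θ, dϑ | a) A(θ, ϑ | a) + R(θ | a) δ_θ(dϑ)`, where
`R(θ | a) = 1 - ∫ Q(θ, dϑ | a) A(θ, ϑ | a)`. -/
def metropolisKernel (Q : Kernel (α × β) β) [IsSFiniteKernel Q] (A : α → β → β → unitInterval) :
    Kernel (α × β) β :=
  Q.withDensity (fun z v => ENNReal.ofReal (A z.1 z.2 v)) +
    (Kernel.deterministic (Prod.snd : α × β → β) measurable_snd).withDensity
      (fun z _ => 1 - ∫⁻ v, ENNReal.ofReal (A z.1 z.2 v) ∂(Q z))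

theorem isMarkovKernel_metropolisKernel (Q : Kernel (α × β) β) [IsMarkovKernel Q]
    (A : α → β → β → unitInterval)
    (hA : Measurable fun z : (α × β) × β => A z.1.1 z.1.2 z.2) :
    IsMarkovKernel (metropolisKernel Q A) := by
  have h1 : Measurable (Function.uncurry fun (z : α × β) (v : β) =>
      ENNReal.ofReal (A z.1 z.2 v)) :=
    ENNReal.measurable_ofReal.comp (measurable_subtype_coe.comp hA)
  have h2 : Measurable (Function.uncurry fun (z : α × β) (_ : β) =>
      1 - ∫⁻ v, ENNReal.ofReal (A z.1 z.2 v) ∂(Q z)) :=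
    (measurable_const.sub (Measurable.lintegral_kernel_prod_right h1)).comp measurable_fst
  refine ⟨fun z => ⟨?_⟩⟩
  have h3 : ∫⁻ v, ENNReal.ofReal (A z.1 z.2 v) ∂(Q z) ≤ 1 := by
    calc ∫⁻ v, ENNReal.ofReal (A z.1 z.2 v) ∂(Q z) ≤ ∫⁻ _, 1 ∂(Q z) :=
          lintegral_mono fun v => ENNReal.ofReal_le_one.2 (A z.1 z.2 v).2.2
      _ = 1 := by simp
  rw [metropolisKernel, add_apply, Measure.add_apply, Kernel.withDensity_apply' _ h1,
    Kernel.withDensity_apply' _ h2]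
  simp only [Measure.restrict_univ, lintegral_const, measure_univ, mul_one]
  exact add_tsub_cancel_of_le h3

end Metropolis

/-- A Metropolis--Hastings algorithm on the parameter space `T` for data in `𝒳`: the target
(quasi-posterior) kernel `Π(dθ | x)`, the proposal kernel `Q(θ, dϑ | x)` and the acceptance
probability `A(θ, ϑ | x)`, subject to the detailed balance
`Π(dθ | x) Q(θ, dϑ | x) A(θ, ϑ | x) = Π(dϑ | x) Q(ϑ, dθ | x) A(ϑ, θ | x)`. -/
structure MetropolisHastings (𝒳 T : Type*) [MeasurableSpace 𝒳] [MeasurableSpace T] where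
  target : Kernel 𝒳 T
  proposal : Kernel (𝒳 × T) T
  accept : 𝒳 → T → T → unitInterval
  isMarkovKernel_target : IsMarkovKernel target
  isMarkovKernel_proposal : IsMarkovKernel proposal
  measurable_accept : Measurable fun z : (𝒳 × T) × T => accept z.1.1 z.1.2 z.2
  balance : ∀ x,
    ((target x ⊗ₘ proposal.sectR x).withDensity
        fun z => ENNReal.ofReal (accept x z.1 z.2)).map Prod.swap =
      (target x ⊗ₘ proposal.sectR x).withDensity fun z => ENNReal.ofReal (accept x z.1 z.2)

namespace MetropolisHastings

variable {𝒳 T : Type*} [MeasurableSpace 𝒳] [MeasurableSpace T] (M : MetropolisHastings 𝒳 T)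

instance : IsMarkovKernel M.target := M.isMarkovKernel_target

instance : IsMarkovKernel M.proposal := M.isMarkovKernel_proposal

/-- The transition kernel `P(θ, dϑ | x)` of the algorithm. -/
def kernel : Kernel (𝒳 × T) T := metropolisKernel M.proposal M.accept

instance : IsMarkovKernel M.kernel :=
  isMarkovKernel_metropolisKernel M.proposal M.accept M.measurable_accept

/-- One step of the algorithm together with the data: `(x, θ) ↦ (x, ϑ)` with
`ϑ ∼ P(θ, dϑ | x)`. -/
def step : Kernel (𝒳 × T) (𝒳 × T) :=
  Kernel.deterministic Prod.fst measurable_fst ×ₖ M.kernel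

instance : IsMarkovKernel M.step := by unfold step; infer_instance

/-- Given the data `x`, the law on `ℕ → T` of the Markov chain `θ_0, θ_1, …` with
`θ_0 ∼ Π(dθ | x)` and transition kernel `P(θ, dϑ | x)`. It is built as the law of the second
coordinate of the chain `(x, θ_m)`, which starts from `δ_x ⊗ Π(dθ | x)` and moves by `step`. -/
def chain : Kernel 𝒳 (ℕ → T) :=
  (Kernel.traj (X := fun _ : ℕ => 𝒳 × T)
      (fun n => M.step.comap (fun h => h ⟨n, Finset.mem_Iic.2 le_rfl⟩) (measurable_pi_apply _)) 0
    ∘ₖ (Kernel.id ×ₖ M.target).map fun z (_ : Finset.Iic 0) => z).map fun ω m => (ω m).2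

end MetropolisHastings

/-! ### Local consistency -/

/-- The empirical distribution `M⁻¹ ∑_{m < M} δ_{θ_m}`. -/
def empiricalDist {T : Type*} [MeasurableSpace T] (M : ℕ) (θ : ℕ → T) : Measure T :=
  (M : ℝ≥0∞)⁻¹ • ∑ m ∈ Finset.range M, Measure.dirac (θ m)

/-- The local coordinate `u = D (θ - θ₀)`. The image of a measure `F(dθ)` under this map is
the rescaled measure `F(θ₀ + D⁻¹ du)`. -/
def localCoord {p : ℕ} {Θ : Set (EuclideanSpace ℝ (Fin p))} (D : Matrix (Fin p) (Fin p) ℝ)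
    (θ₀ θ : Θ) : EuclideanSpace ℝ (Fin p) :=
  Matrix.toEuclideanCLM (𝕜 := ℝ) D ((θ : EuclideanSpace ℝ (Fin p)) - θ₀)

/-- The parameter `θ₀ + D⁻¹ u`, which need not lie in `Θ`. -/
def localParam {p : ℕ} {Θ : Set (EuclideanSpace ℝ (Fin p))} (D : Matrix (Fin p) (Fin p) ℝ)
    (θ₀ : Θ) (u : EuclideanSpace ℝ (Fin p)) : EuclideanSpace ℝ (Fin p) :=
  θ₀ + Matrix.toEuclideanCLM (𝕜 := ℝ) D⁻¹ u

/-- Local consistency at `θ₀`: the bounded Lipschitz distance between the rescaled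
quasi-posterior and the rescaled empirical distribution of the first `M` states of the chain
tends to `0` as `N, M → ∞`, in probability under the joint law of the data `x ∼ P N` and of the
chain generated from them. -/
def LocallyConsistent {p : ℕ} {Θ : Set (EuclideanSpace ℝ (Fin p))} {𝒳 : ℕ → Type*}
    [∀ N, MeasurableSpace (𝒳 N)] (P : ∀ N, Measure (𝒳 N))
    (D : ℕ → Matrix (Fin p) (Fin p) ℝ) (θ₀ : Θ) (M : ∀ N, MetropolisHastings (𝒳 N) Θ) : Prop :=
  TendstoZeroInProb (ι := ℕ × ℕ) (Ω := fun k => 𝒳 k.1 × (ℕ → Θ)) (atTop ×ˢ atTop)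
    (fun k => P k.1 ⊗ₘ (M k.1).chain)
    (fun k z => blDist (((M k.1).target z.1).map (localCoord (D k.1) θ₀))
      ((empiricalDist k.2 z.2).map (localCoord (D k.1) θ₀)))

/-! ### The limit kernel -/

/-- The data of the limit: densities `π(u | s)` and `q(u, v | s)` with respect to Lebesgue
measure, and acceptance probabilities `A(u, v | s)`. -/
structure LimitModel (S : Type*) [MeasurableSpace S] (p : ℕ) where
  targetDensity : S → EuclideanSpace ℝ (Fin p) → ℝ≥0
  proposalDensity : S → EuclideanSpace ℝ (Fin p) → EuclideanSpace ℝ (Fin p) → ℝ≥0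
  accept : S → EuclideanSpace ℝ (Fin p) → EuclideanSpace ℝ (Fin p) → unitInterval
  measurable_targetDensity :
    Measurable fun z : S × EuclideanSpace ℝ (Fin p) => targetDensity z.1 z.2
  measurable_proposalDensity :
    Measurable fun z : (S × EuclideanSpace ℝ (Fin p)) × EuclideanSpace ℝ (Fin p) =>
      proposalDensity z.1.1 z.1.2 z.2
  measurable_accept :
    Measurable fun z : (S × EuclideanSpace ℝ (Fin p)) × EuclideanSpace ℝ (Fin p) =>
      accept z.1.1 z.1.2 z.2
  lintegral_targetDensity : ∀ s, ∫⁻ u, (targetDensity s u : ℝ≥0∞) = 1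
  lintegral_proposalDensity : ∀ s u, ∫⁻ v, (proposalDensity s u v : ℝ≥0∞) = 1

namespace LimitModel

variable {S : Type*} [MeasurableSpace S] {p : ℕ} (L : LimitModel S p)

/-- `Π(du | s) = π(u | s) du`. -/
def target : Kernel S (EuclideanSpace ℝ (Fin p)) :=
  (Kernel.const S volume).withDensity fun s u => (L.targetDensity s u : ℝ≥0∞)

/-- `Q(u, dv | s) = q(u, v | s) dv`. -/
def proposal : Kernel (S × EuclideanSpace ℝ (Fin p)) (EuclideanSpace ℝ (Fin p)) :=
  (Kernel.const _ volume).withDensity fun z v => (L.proposalDensity z.1 z.2 v : ℝ≥0∞)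

instance : IsMarkovKernel L.target := by
  refine ⟨fun s => ⟨?_⟩⟩
  rw [target, Kernel.withDensity_apply' _ (by
    exact measurable_coe_nnreal_ennreal.comp L.measurable_targetDensity)]
  simpa using L.lintegral_targetDensity s

instance : IsMarkovKernel L.proposal := by
  refine ⟨fun z => ⟨?_⟩⟩
  rw [proposal, Kernel.withDensity_apply' _ (by
    exact measurable_coe_nnreal_ennreal.comp L.measurable_proposalDensity)]
  simpa using L.lintegral_proposalDensity z.1 z.2

/-- `P(u, dv | s) = Q(u, dv | s) A(u, v | s) + R(u | s) δ_u(dv)`. -/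
def kernel : Kernel (S × EuclideanSpace ℝ (Fin p)) (EuclideanSpace ℝ (Fin p)) :=
  metropolisKernel L.proposal L.accept

/-- Regularity of the limit kernel: `π(u | s)`, `q(u, v | s)`, `A(u, v | s)` are continuous
in `s`, and `π(u | s) + q(u, v | s)` is bounded uniformly in `u, v` and in `s ∈ K`, for every
compact `K`. -/
structure IsRegular [TopologicalSpace S] : Prop where
  continuous_targetDensity : ∀ u, Continuous fun s => L.targetDensity s u
  continuous_proposalDensity : ∀ u v, Continuous fun s => L.proposalDensity s u v
  continuous_accept : ∀ u v, Continuous fun s => L.accept s u v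
  bounded : ∀ K : Set S, IsCompact K →
    ∃ C : ℝ≥0, ∀ s ∈ K, ∀ u v, L.targetDensity s u + L.proposalDensity s u v ≤ C

end LimitModel

/-- `κ` is ergodic with invariant measure `μ`: it is `φ`-irreducible for some nonzero `σ`-finite
`φ`, recurrent (from every starting point, the expected number of visits to every set charged by
an irreducibility measure is infinite), and `μ` is invariant. For a probability measure `μ` this
says that `κ` is irreducible and positive recurrent, with invariant law `μ`. -/
structure IsErgodicKernel {E : Type*} [MeasurableSpace E] (κ : Kernel E E) (μ : Measure E) :
    Prop where
  irreducible : ∃ φ : Measure E, SigmaFinite φ ∧ φ ≠ 0 ∧ Kernel.IsIrreducible φ κ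
  recurrent : ∀ φ : Measure E, SigmaFinite φ → Kernel.IsIrreducible φ κ →
    ∀ B, MeasurableSet B → 0 < φ B → ∀ x, ∑' n : ℕ, (κ ^ n) x B = ∞
  invariant : Kernel.Invariant κ μ

end

/-! Detailed balance makes the quasi-posterior invariant for the Metropolis kernel, so the chain is
stationary. For a stationary chain and a centred `g` with `|g| ≤ 1`, expanding the square bounds the
second moment of an average over `M` states by `2 (‖k⁻¹ ∑_{j<k} κ^j g‖₁ + k / M)`, for every `k`
(`integral_sq_average_le`). The point is that only `k` steps of the kernel enter, with `k` fixed
while `M` grows. No mixing rate for the chains at stage `N` is needed, and a fixed number of steps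
can be compared with the limit kernel.

For the limit kernel at a fixed `σ`, von Neumann's mean ergodic theorem applies in `L²`.
Irreducibility forces the fixed vectors to be constant, so the `k`-step averages of a centred
function tend to zero (`tendsto_integral_abs_kernelSum`). If the pair (state, proposal), with and
without the acceptance weight, is within `a` of the limit in total variation, then one step of the
kernels differs by at most `4a` in `L¹`, and `j` steps by at most `4ja`
(`integral_abs_kernelAct_sub_le`, `integral_abs_iterate_sub_le`). One picks `k` from the limit
kernel alone, then `a` small and `M` large.

The bounded Lipschitz distance is a supremum over an uncountable family. It is replaced by a
countable sum over a partition into small cells (`ofReal_blDist_le`): finitely many cells are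
treated by the second moment bound, and the others contribute on average at most twice their mass.
This yields a mean error bound that is uniform over all data for which the algorithm is close to the
limit at `σ` (`exists_forall_lintegral_partitionDist_le`).

It remains to let `s_N` vary. Scheffé's lemma and dominated convergence show that the limit models
at `s_N` and at `σ` are close when `s_N` is near `σ`. Pointwise convergence in probability of the
acceptance probabilities becomes convergence in mean under the law at `σ`, by Fubini, because that
law does not depend on the data. Hence every `σ` has a neighbourhood on which the mean error is
small off events of vanishing probability (`exists_mem_nhds_smallMeanErrorOn`). Compactness,
tightness of `s_N` and Markov's inequality conclude. -/

/-! ### Bounded measurable functions and the action of Markov kernels -/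

section KernelAct

variable {T : Type*} [MeasurableSpace T]

/-- `f` is measurable and bounded by `c` in absolute value. -/
def BddMeasurable (c : ℝ) (f : T → ℝ) : Prop := Measurable f ∧ ∀ x, |f x| ≤ c

/-- The function `u ↦ ∫ f(v) κ(u, dv)`. -/
noncomputable def kernelAct (κ : Kernel T T) (f : T → ℝ) (u : T) : ℝ := ∫ v, f v ∂κ u

/-- The sum of the first `k` iterates `f + κ f + ⋯ + κ^(k-1) f`. -/
noncomputable def kernelSum (κ : Kernel T T) (k : ℕ) (f : T → ℝ) (u : T) : ℝ :=
  ∑ j ∈ Finset.range k, (kernelAct κ)^[j] f u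

variable {κ : Kernel T T} {f g : T → ℝ} {c c' : ℝ} {μ : Measure T}

theorem BddMeasurable.integrable {T : Type*} [MeasurableSpace T] {f : T → ℝ} {c : ℝ}
    (hf : BddMeasurable c f) (μ : Measure T) [IsFiniteMeasure μ] : Integrable f μ :=
  Integrable.of_bound hf.1.aestronglyMeasurable c (ae_of_all _ hf.2)

theorem BddMeasurable.comp {T' : Type*} [MeasurableSpace T'] (hf : BddMeasurable c f)
    {l : T' → T} (hl : Measurable l) : BddMeasurable c (f ∘ l) :=
  ⟨hf.1.comp hl, fun _ => hf.2 _⟩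

theorem BddMeasurable.add (hf : BddMeasurable c f) (hg : BddMeasurable c' g) :
    BddMeasurable (c + c') (fun x => f x + g x) :=
  ⟨hf.1.add hg.1, fun x => (abs_add_le _ _).trans (add_le_add (hf.2 x) (hg.2 x))⟩

theorem BddMeasurable.sub (hf : BddMeasurable c f) (hg : BddMeasurable c' g) :
    BddMeasurable (c + c') (fun x => f x - g x) :=
  ⟨hf.1.sub hg.1, fun x => (abs_sub _ _).trans (add_le_add (hf.2 x) (hg.2 x))⟩

theorem BddMeasurable.mul (hf : BddMeasurable c f) (hg : BddMeasurable c' g) :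
    BddMeasurable (c * c') (fun x => f x * g x) :=
  ⟨hf.1.mul hg.1, fun x => by
    rw [abs_mul]
    exact mul_le_mul (hf.2 x) (hg.2 x) (abs_nonneg _) ((abs_nonneg _).trans (hf.2 x))⟩

theorem BddMeasurable.abs (hf : BddMeasurable c f) : BddMeasurable c (fun x => |f x|) :=
  ⟨measurable_norm.comp hf.1, fun x => by simpa using hf.2 x⟩

theorem BddMeasurable.sum {ι : Type*} (s : Finset ι) {f : ι → T → ℝ} {c : ι → ℝ}
    (hf : ∀ i ∈ s, BddMeasurable (c i) (f i)) :
    BddMeasurable (∑ i ∈ s, c i) (fun x => ∑ i ∈ s, f i x) :=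
  ⟨Finset.measurable_fun_sum _ fun i hi => (hf i hi).1,
    fun x => (Finset.abs_sum_le_sum_abs _ _).trans (Finset.sum_le_sum fun i hi => (hf i hi).2 x)⟩

theorem BddMeasurable.act [IsMarkovKernel κ] (hf : BddMeasurable c f) :
    BddMeasurable c (kernelAct κ f) := by
  refine ⟨(hf.1.stronglyMeasurable.integral_kernel (κ := κ)).measurable, fun x => ?_⟩
  simpa [kernelAct] using norm_integral_le_of_norm_le_const (μ := κ x) (f := f) (ae_of_all _ hf.2)

theorem BddMeasurable.iterate [IsMarkovKernel κ] (hf : BddMeasurable c f) (j : ℕ) :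
    BddMeasurable c ((kernelAct κ)^[j] f) := by
  induction j with
  | zero => exact hf
  | succ j ih => rw [Function.iterate_succ_apply']; exact ih.act

theorem BddMeasurable.kernelSum [IsMarkovKernel κ] (hf : BddMeasurable c f) (k : ℕ) :
    BddMeasurable (k * c) (kernelSum κ k f) := by
  have := BddMeasurable.sum (Finset.range k) (fun j _ => hf.iterate (κ := κ) j)
  rw [Finset.sum_const, Finset.card_range, nsmul_eq_mul] at this
  exact this

theorem BddMeasurable.abs_integral_le (hf : BddMeasurable c f) [IsProbabilityMeasure μ] :
    |∫ x, f x ∂μ| ≤ c := by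
  simpa using norm_integral_le_of_norm_le_const (μ := μ) (f := f) (ae_of_all _ hf.2)

theorem kernelAct_add [IsMarkovKernel κ] (hf : BddMeasurable c f) (hg : BddMeasurable c' g) :
    kernelAct κ (fun x => f x + g x) = fun x => kernelAct κ f x + kernelAct κ g x :=
  funext fun _ => integral_add (hf.integrable _) (hg.integrable _)

theorem kernelAct_sub [IsMarkovKernel κ] (hf : BddMeasurable c f) (hg : BddMeasurable c' g) :
    kernelAct κ (fun x => f x - g x) = fun x => kernelAct κ f x - kernelAct κ g x :=
  funext fun _ => integral_sub (hf.integrable _) (hg.integrable _)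

theorem kernelAct_const [IsMarkovKernel κ] (a : ℝ) :
    kernelAct κ (fun _ => a) = fun _ => a := by
  funext x; simp [kernelAct]

theorem iterate_kernelAct_sub_const [IsMarkovKernel κ] (hf : BddMeasurable c f) (a : ℝ) (j : ℕ) :
    (kernelAct κ)^[j] (fun x => f x - a) = fun x => (kernelAct κ)^[j] f x - a := by
  have ha : BddMeasurable |a| (fun _ : T => a) := ⟨measurable_const, fun _ => le_rfl⟩
  induction j with
  | zero => rfl
  | succ j ih =>
    rw [Function.iterate_succ_apply', ih, kernelAct_sub (hf.iterate j) ha, kernelAct_const,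
      Function.iterate_succ_apply']

theorem integral_kernelAct [IsMarkovKernel κ] [IsProbabilityMeasure μ]
    (h : Kernel.Invariant κ μ) (hf : BddMeasurable c f) :
    ∫ x, kernelAct κ f x ∂μ = ∫ x, f x ∂μ := by
  have h2 : (μ ⊗ₘ κ).map Prod.snd = μ := (Measure.snd_compProd μ κ).trans h
  have h1 : ∫ z, f z.2 ∂(μ ⊗ₘ κ) = ∫ x, f x ∂μ := by
    conv_rhs => rw [← h2]
    rw [integral_map measurable_snd.aemeasurable hf.1.aestronglyMeasurable]
  rw [← h1, Measure.integral_compProd]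
  · rfl
  · exact (hf.comp measurable_snd).integrable _

/-- Jensen's inequality pointwise, then invariance applied to `|f|`. This `L¹` contraction is what
keeps errors from growing under iteration. -/
theorem integral_abs_kernelAct_le [IsMarkovKernel κ] [IsProbabilityMeasure μ]
    (h : Kernel.Invariant κ μ) (hf : BddMeasurable c f) :
    ∫ x, |kernelAct κ f x| ∂μ ≤ ∫ x, |f x| ∂μ := by
  rw [← integral_kernelAct h hf.abs]
  exact integral_mono (hf.act.abs.integrable _) (hf.abs.act.integrable _) fun x =>
    abs_integral_le_integral_abs

theorem integral_abs_iterate_kernelAct_le [IsMarkovKernel κ] [IsProbabilityMeasure μ]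
    (h : Kernel.Invariant κ μ) (hf : BddMeasurable c f) (j : ℕ) :
    ∫ x, |(kernelAct κ)^[j] f x| ∂μ ≤ ∫ x, |f x| ∂μ := by
  induction j with
  | zero => exact le_rfl
  | succ j ih =>
    rw [Function.iterate_succ_apply']
    exact (integral_abs_kernelAct_le h (hf.iterate j)).trans ih

theorem iterate_kernelAct_add [IsMarkovKernel κ] (hf : BddMeasurable c f)
    (hg : BddMeasurable c' g) (j : ℕ) :
    (kernelAct κ)^[j] (fun x => f x + g x) =
      fun x => (kernelAct κ)^[j] f x + (kernelAct κ)^[j] g x := by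
  induction j with
  | zero => rfl
  | succ j ih =>
    rw [Function.iterate_succ_apply', ih, kernelAct_add (hf.iterate j) (hg.iterate j),
      Function.iterate_succ_apply', Function.iterate_succ_apply']

theorem iterate_kernelAct_kernelSum [IsMarkovKernel κ] (hf : BddMeasurable c f) (i k : ℕ) :
    (kernelAct κ)^[i] (kernelSum κ k f) =
      fun x => ∑ j ∈ Finset.range k, (kernelAct κ)^[i + j] f x := by
  induction k with
  | zero =>
    have h0 : kernelSum κ 0 f = fun _ => 0 := by funext x; simp [kernelSum]
    rw [h0]
    induction i with
    | zero => simp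
    | succ i ih => rw [Function.iterate_succ_apply', ih]; simp [kernelAct_const]
  | succ k ih =>
    have h0 : kernelSum κ (k + 1) f = fun x => kernelSum κ k f x + (kernelAct κ)^[k] f x := by
      funext x; simp [kernelSum, Finset.sum_range_succ]
    rw [h0, iterate_kernelAct_add (hf.kernelSum k) (hf.iterate k), ih]
    funext x
    rw [Finset.sum_range_succ, Function.iterate_add_apply]

/-- The `L¹`-norm of `kernelSum κ n f` is controlled by that of `kernelSum κ k f`. -/
theorem integral_abs_kernelSum_le [IsMarkovKernel κ] [IsProbabilityMeasure μ]
    (h : Kernel.Invariant κ μ) (hf : BddMeasurable c f) (k m r : ℕ) :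
    ∫ x, |kernelSum κ (m * k + r) f x| ∂μ ≤ m * ∫ x, |kernelSum κ k f x| ∂μ + r * c := by
  induction m with
  | zero =>
    simpa using (hf.kernelSum r).abs.abs_integral_le (μ := μ) |> (le_abs_self _).trans
  | succ m ih =>
    -- The last block of `k` terms is an iterate applied to the sum of the first `k`; by contraction
    -- each block costs no more than the first one.
    have h0 : kernelSum κ ((m + 1) * k + r) f = fun x =>
        (kernelAct κ)^[m * k + r] (kernelSum κ k f) x + kernelSum κ (m * k + r) f x := by
      rw [iterate_kernelAct_kernelSum hf]
      funext x
      rw [show (m + 1) * k + r = (m * k + r) + k by ring, kernelSum, Finset.sum_range_add, add_comm]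
      rfl
    have h1 := (hf.kernelSum (κ := κ) k).iterate (κ := κ) (m * k + r)
    have h2 := hf.kernelSum (κ := κ) (m * k + r)
    calc ∫ x, |kernelSum κ ((m + 1) * k + r) f x| ∂μ
        ≤ ∫ x, (|(kernelAct κ)^[m * k + r] (kernelSum κ k f) x|
            + |kernelSum κ (m * k + r) f x|) ∂μ := by
          rw [h0]
          exact integral_mono ((h1.add h2).abs.integrable _)
            ((h1.abs.add h2.abs).integrable _) fun x => abs_add_le _ _
      _ = ∫ x, |(kernelAct κ)^[m * k + r] (kernelSum κ k f) x| ∂μ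
            + ∫ x, |kernelSum κ (m * k + r) f x| ∂μ :=
          integral_add (h1.abs.integrable _) (h2.abs.integrable _)
      _ ≤ _ := by
          have := integral_abs_iterate_kernelAct_le h (hf.kernelSum (κ := κ) k) (m * k + r)
          push_cast
          linarith

/-- Division of `n` by `k` into full blocks and a remainder of fewer than `k` terms, each at most
`c`. -/
theorem integral_abs_kernelSum_le_div [IsMarkovKernel κ] [IsProbabilityMeasure μ]
    (h : Kernel.Invariant κ μ) (hf : BddMeasurable c f) {k : ℕ} (hk : 0 < k) (n : ℕ) :
    ∫ x, |kernelSum κ n f x| ∂μ ≤ n * ((∫ x, |kernelSum κ k f x| ∂μ) / k) + k * c := by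
  have h1 := integral_abs_kernelSum_le h hf k (n / k) (n % k)
  have hc : 0 ≤ c := by
    have := (nonempty_of_isProbabilityMeasure μ)
    exact (abs_nonneg _).trans (hf.2 this.some)
  rw [Nat.div_add_mod'] at h1
  have h2 : 0 ≤ ∫ x, |kernelSum κ k f x| ∂μ := integral_nonneg fun _ => abs_nonneg _
  have h3 : ((n / k : ℕ) : ℝ) ≤ n / k := Nat.cast_div_le
  have h4 : ((n % k : ℕ) : ℝ) ≤ k := by exact_mod_cast (Nat.mod_lt n hk).le
  calc _ ≤ _ := h1
    _ ≤ (n / k : ℝ) * ∫ x, |kernelSum κ k f x| ∂μ + k * c := by gcongr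
    _ = _ := by ring

end KernelAct

/-! ### The law of large numbers for stationary chains -/

section StationaryChain

variable {T Ω : Type*} [MeasurableSpace T] [MeasurableSpace Ω]

/-- Second moment bound for the ergodic averages of a stationary Markov chain. -/
theorem integral_sq_average_le {κ : Kernel T T} [IsMarkovKernel κ] {μ : Measure T}
    [IsProbabilityMeasure μ] (h : Kernel.Invariant κ μ) {ρ : Measure Ω} [IsProbabilityMeasure ρ]
    {θ : ℕ → Ω → T} (hθ : ∀ i, Measurable (θ i)) {g : T → ℝ} (hg : BddMeasurable 1 g)
    (hpair : ∀ i j, ∫ ω, g (θ i ω) * g (θ (i + j) ω) ∂ρ =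
      ∫ u, g u * (kernelAct κ)^[j] g u ∂μ) {k : ℕ} (hk : 0 < k) {M : ℕ} (hM : 0 < M) :
    ∫ ω, ((M : ℝ)⁻¹ * ∑ m ∈ Finset.range M, g (θ m ω)) ^ 2 ∂ρ ≤
      2 * ((∫ x, |kernelSum κ k g x| ∂μ) / k + k / M) := by
  have hb : ∀ i, BddMeasurable 1 (fun ω => g (θ i ω)) := fun i => hg.comp (hθ i)
  have hbb : ∀ i j, Integrable (fun ω => g (θ i ω) * g (θ j ω)) ρ := fun i j =>
    ((hb i).mul (hb j)).integrable _
  set a : ℝ := (∫ x, |kernelSum κ k g x| ∂μ) / k with ha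
  have ha0 : 0 ≤ a := by positivity
  -- partial sums of second moments
  have key : ∀ n : ℕ, ∫ ω, (∑ m ∈ Finset.range n, g (θ m ω)) ^ 2 ∂ρ ≤
      2 * ∑ i ∈ Finset.range n, ∫ u, g u * kernelSum κ (n - i) g u ∂μ := by
    intro n
    have e1 : ∀ i ∈ Finset.range n, ∫ u, g u * kernelSum κ (n - i) g u ∂μ =
        ∑ j ∈ Finset.Ico i n, ∫ ω, g (θ i ω) * g (θ j ω) ∂ρ := by
      intro i hi
      rw [Finset.sum_Ico_eq_sum_range]
      simp_rw [hpair]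
      rw [← integral_finsetSum]
      · congr 1; funext u; rw [kernelSum, Finset.mul_sum]
      · intro j _; exact (hg.mul (hg.iterate j)).integrable _
    have e2 : ∫ ω, (∑ m ∈ Finset.range n, g (θ m ω)) ^ 2 ∂ρ =
        ∑ i ∈ Finset.range n, ∑ j ∈ Finset.range n, ∫ ω, g (θ i ω) * g (θ j ω) ∂ρ := by
      simp_rw [sq, Finset.sum_mul_sum]
      rw [integral_finsetSum _ fun i _ => integrable_finsetSum _ fun j _ => hbb i j]
      refine Finset.sum_congr rfl fun i _ => ?_
      rw [integral_finsetSum _ fun j _ => hbb i j]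
    rw [Finset.sum_congr rfl e1, e2]
    clear e1 e2
    -- The doubled triangular sum contains the diagonal twice, while the full square contains it
    -- once; the surplus `E g(θ_n)²` is nonnegative.
    induction n with
    | zero => simp
    | succ n ih =>
      simp only [Finset.sum_range_succ, Finset.sum_add_distrib]
      have e3 : ∀ i ∈ Finset.range n, ∑ j ∈ Finset.Ico i (n + 1), ∫ ω, g (θ i ω) * g (θ j ω) ∂ρ
          = ∑ j ∈ Finset.Ico i n, ∫ ω, g (θ i ω) * g (θ j ω) ∂ρ
            + ∫ ω, g (θ i ω) * g (θ n ω) ∂ρ := fun i hi => by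
        rw [Finset.sum_Ico_succ_top (Finset.mem_range.1 hi).le]
      rw [Finset.sum_congr rfl e3, Finset.sum_add_distrib]
      simp only [Nat.Ico_succ_singleton, Finset.sum_singleton]
      have e4 : ∑ j ∈ Finset.range n, ∫ ω, g (θ n ω) * g (θ j ω) ∂ρ =
          ∑ j ∈ Finset.range n, ∫ ω, g (θ j ω) * g (θ n ω) ∂ρ := by
        simp_rw [mul_comm]
      have e5 : 0 ≤ ∫ ω, g (θ n ω) * g (θ n ω) ∂ρ := integral_nonneg fun _ => mul_self_nonneg _
      rw [e4]
      linarith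
  -- A bound independent of the starting index `i`, since the remaining length `M - i` is at most
  -- `M`.
  have bound : ∀ n : ℕ, n ≤ M → ∫ u, g u * kernelSum κ n g u ∂μ ≤ M * a + k := by
    intro n hn
    have hs := hg.kernelSum (κ := κ) n
    calc ∫ u, g u * kernelSum κ n g u ∂μ ≤ ∫ u, |kernelSum κ n g u| ∂μ := by
          refine integral_mono ((hg.mul hs).integrable _) (hs.abs.integrable _) fun u => ?_
          calc g u * kernelSum κ n g u ≤ |g u| * |kernelSum κ n g u| := by
                rw [← abs_mul]; exact le_abs_self _
            _ ≤ 1 * |kernelSum κ n g u| := by gcongr; exact hg.2 u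
            _ = _ := one_mul _
      _ ≤ n * a + k * 1 := integral_abs_kernelSum_le_div h hg hk n
      _ ≤ M * a + k := by
          have : (n : ℝ) ≤ M := by exact_mod_cast hn
          nlinarith
  have hM' : (0 : ℝ) < M := by exact_mod_cast hM
  calc ∫ ω, ((M : ℝ)⁻¹ * ∑ m ∈ Finset.range M, g (θ m ω)) ^ 2 ∂ρ
      = (M : ℝ)⁻¹ ^ 2 * ∫ ω, (∑ m ∈ Finset.range M, g (θ m ω)) ^ 2 ∂ρ := by
        simp_rw [mul_pow]; rw [integral_const_mul]
    _ ≤ (M : ℝ)⁻¹ ^ 2 * (2 * ∑ i ∈ Finset.range M, (M * a + k)) := by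
        gcongr
        refine (key M).trans ?_
        gcongr with i _
        exact bound _ (Nat.sub_le _ _)
    _ = 2 * (a + k / M) := by
        rw [Finset.sum_const, Finset.card_range, nsmul_eq_mul]
        field_simp

end StationaryChain

/-! ### The mean ergodic theorem for irreducible kernels -/

section Ergodic

variable {T : Type*} [MeasurableSpace T] {κ : Kernel T T} {μ : Measure T}

theorem ae_kernel_of_ae (h : Kernel.Invariant κ μ) {p : T → Prop} (hp : ∀ᵐ u ∂μ, p u) :
    ∀ᵐ u ∂μ, ∀ᵐ v ∂κ u, p v :=
  Measure.ae_ae_of_ae_comp (by rw [h.def]; exact hp)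

theorem invariant_kernel_pow (h : Kernel.Invariant κ μ) (n : ℕ) : Kernel.Invariant (κ ^ n) μ := by
  induction n with
  | zero => exact Measure.id_comp
  | succ n ih => rw [pow_succ']; exact h.comp ih

/-- The one-step property is known only for almost every starting point. It may be used after `n`
steps because `μ` is invariant under `κ ^ n`, so an exceptional null set is almost surely not
visited. -/
theorem ae_pow_of_ae_eq (h : Kernel.Invariant κ μ) {f : T → ℝ} (hf : Measurable f)
    (hfix : ∀ᵐ u ∂μ, ∀ᵐ v ∂κ u, f v = f u) (n : ℕ) :
    ∀ᵐ u ∂μ, ∀ᵐ v ∂(κ ^ n) u, f v = f u := by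
  induction n with
  | zero =>
    refine ae_of_all _ fun u => ?_
    have : (κ ^ 0) u = Measure.dirac u := Kernel.id_apply u
    rw [this, ae_dirac_iff (measurableSet_eq_fun hf measurable_const)]
  | succ n ih =>
    filter_upwards [ih, ae_kernel_of_ae (invariant_kernel_pow h n) hfix] with u hu hu2
    have hms : MeasurableSet {v | f v ≠ f u} := (measurableSet_eq_fun hf measurable_const).compl
    change ((κ ^ (n + 1)) u) {v | f v ≠ f u} = 0
    rw [Kernel.pow_succ_apply_eq_lintegral _ _ _ hms, lintegral_eq_zero_iff (κ.measurable_coe hms)]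
    filter_upwards [hu, hu2] with w hw hw2
    rw [hw] at hw2
    exact hw2

/-- Functions that are almost surely constant along the chain are almost surely constant. -/
theorem exists_ae_eq_const_of_irreducible [IsProbabilityMeasure μ]
    (h : Kernel.Invariant κ μ) {φ : Measure T} (hφ : φ ≠ 0)
    (hirr : Kernel.IsIrreducible φ κ) {f : T → ℝ} (hf : Measurable f)
    (hfix : ∀ᵐ u ∂μ, ∀ᵐ v ∂κ u, f v = f u) : ∃ c, ∀ᵐ u ∂μ, f u = c := by
  -- If `φ` charged this set, irreducibility would let the chain started at `u` reach it with
  -- positive probability, although `f` keeps the value `f u` along the chain.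
  have h1 : ∀ᵐ u ∂μ, φ {v | f v ≠ f u} = 0 := by
    filter_upwards [ae_all_iff.2 (ae_pow_of_ae_eq h hf hfix)] with u hu
    by_contra hne
    obtain ⟨n, hn⟩ := hirr.irreducible
      ((measurableSet_eq_fun hf measurable_const).compl) (pos_iff_ne_zero.2 hne) u
    exact hn.ne' (hu n)
  obtain ⟨u₀, hu₀⟩ := h1.exists
  refine ⟨f u₀, ?_⟩
  filter_upwards [h1] with u hu
  by_contra hne
  apply hφ
  rw [← Measure.measure_univ_eq_zero]
  -- With two different values `f u` and `f u₀`, every point `v` misses at least one of them, so the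
  -- whole space would be `φ`-null.
  refine measure_mono_null (fun v _ => ?_) (measure_union_null hu hu₀)
  by_cases hv : f v = f u
  · exact Or.inr fun h' => hne (hv.symm.trans h')
  · exact Or.inl hv

variable [IsMarkovKernel κ] [IsProbabilityMeasure μ]

theorem measurePreserving_fst_compProd :
    MeasurePreserving Prod.fst (μ ⊗ₘ κ) μ :=
  ⟨measurable_fst, Measure.fst_compProd μ κ⟩

theorem measurePreserving_snd_compProd (h : Kernel.Invariant κ μ) :
    MeasurePreserving Prod.snd (μ ⊗ₘ κ) μ :=
  ⟨measurable_snd, (Measure.snd_compProd μ κ).trans h⟩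

/-- The Markov operator of `κ` on `L²(μ)`. -/
noncomputable def markovL2 (h : Kernel.Invariant κ μ) : Lp ℝ 2 μ →L[ℝ] Lp ℝ 2 μ :=
  (ContinuousLinearMap.adjoint (Lp.compMeasurePreservingₗᵢ ℝ Prod.fst
    (measurePreserving_fst_compProd (κ := κ) (μ := μ))).toContinuousLinearMap).comp
  (Lp.compMeasurePreservingₗᵢ ℝ Prod.snd
    (measurePreserving_snd_compProd h)).toContinuousLinearMap

/-- The operator is `V* U`, where `U` and `V` are the isometries of `L²(μ)` into `L²(μ ⊗ κ)` given
by composition with the second and the first coordinate. -/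
theorem norm_markovL2_le (h : Kernel.Invariant κ μ) : ‖markovL2 h‖ ≤ 1 := by
  refine (ContinuousLinearMap.opNorm_comp_le _ _).trans ?_
  rw [LinearIsometryEquiv.norm_map]
  exact mul_le_one₀ (LinearIsometry.norm_toContinuousLinearMap_le _) (norm_nonneg _)
    (LinearIsometry.norm_toContinuousLinearMap_le _)

theorem inner_markovL2 (h : Kernel.Invariant κ μ) (x y : Lp ℝ 2 μ) :
    inner ℝ x (markovL2 h y) = inner ℝ
      (Lp.compMeasurePreservingₗᵢ ℝ Prod.fst (measurePreserving_fst_compProd (κ := κ) (μ := μ)) x)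
      (Lp.compMeasurePreservingₗᵢ ℝ Prod.snd (measurePreserving_snd_compProd h) y) := by
  rw [markovL2, ContinuousLinearMap.comp_apply, ContinuousLinearMap.adjoint_inner_right]
  rfl

theorem BddMeasurable.memLp {f : T → ℝ} {c : ℝ} (hf : BddMeasurable c f) : MemLp f 2 μ :=
  MemLp.of_bound hf.1.aestronglyMeasurable c (ae_of_all _ hf.2)

/-- An `L²` function is determined by its integrals over measurable sets `s`. Paired with the
indicator of `s`, the left side is an integral under the joint law `μ ⊗ κ`, and disintegration turns
it into the integral of `κ f` over `s`. -/
theorem markovL2_toLp (h : Kernel.Invariant κ μ) {f : T → ℝ} {c : ℝ} (hf : BddMeasurable c f) :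
    markovL2 h (hf.memLp.toLp f) = hf.act.memLp.toLp (kernelAct κ f) := by
  refine Lp.ext ?_
  refine Integrable.ae_eq_of_forall_setIntegral_eq _ _ ((Lp.memLp _).integrable one_le_two)
    ((Lp.memLp _).integrable one_le_two) fun s hs _ => ?_
  have hi : BddMeasurable 1 (s.indicator fun _ => (1 : ℝ)) :=
    ⟨measurable_const.indicator hs, fun x => by by_cases hx : x ∈ s <;> simp [hx]⟩
  rw [← L2.inner_indicatorConstLp_one hs (measure_ne_top _ _), inner_markovL2, L2.inner_def]
  have e1 := Lp.coeFn_compMeasurePreserving (indicatorConstLp 2 hs (measure_ne_top μ s) (1 : ℝ))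
    (measurePreserving_fst_compProd (κ := κ) (μ := μ))
  have e2 := Lp.coeFn_compMeasurePreserving (hf.memLp.toLp f) (measurePreserving_snd_compProd h)
  have e3 := (measurePreserving_fst_compProd (κ := κ) (μ := μ)).quasiMeasurePreserving.ae_eq_comp
    (indicatorConstLp_coeFn (p := 2) (hs := hs) (hμs := measure_ne_top μ s) (c := (1 : ℝ)))
  have e4 := (measurePreserving_snd_compProd h).quasiMeasurePreserving.ae_eq_comp
    (hf.memLp (μ := μ)).coeFn_toLp
  have e5 : ∫ z, s.indicator (fun _ => (1 : ℝ)) z.1 * f z.2 ∂(μ ⊗ₘ κ) =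
      ∫ u in s, kernelAct κ f u ∂μ := by
    have hint : Integrable (fun z : T × T => s.indicator (fun _ => (1 : ℝ)) z.1 * f z.2)
        (μ ⊗ₘ κ) := ((hi.comp measurable_fst).mul (hf.comp measurable_snd)).integrable _
    rw [Measure.integral_compProd hint, ← integral_indicator hs]
    congr 1
    funext u
    change ∫ b, s.indicator (fun _ => (1 : ℝ)) u * f b ∂κ u = _
    rw [integral_const_mul]
    by_cases hu : u ∈ s <;> simp [hu, kernelAct]
  rw [setIntegral_congr_ae hs (hf.act.memLp.coeFn_toLp.mono fun _ h _ => h), ← e5]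
  refine integral_congr_ae ?_
  filter_upwards [e1, e2, e3, e4] with z h1 h2 h3 h4
  have h5 : (Lp.compMeasurePreservingₗᵢ ℝ Prod.fst
      (measurePreserving_fst_compProd (κ := κ) (μ := μ))
      (indicatorConstLp 2 hs (measure_ne_top μ s) (1 : ℝ))) z = s.indicator (fun _ => 1) z.1 :=
    h1.trans h3
  have h6 : (Lp.compMeasurePreservingₗᵢ ℝ Prod.snd (measurePreserving_snd_compProd h)
      (hf.memLp.toLp f)) z = f z.2 := h2.trans h4
  rw [h5, h6]
  simp [mul_comm]

/-- Equality case of Cauchy–Schwarz: `⟨V x, U x⟩ = ⟨x, V* U x⟩ = ‖x‖²`, while `V x` and `U x` both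
have norm `‖x‖`, so they coincide. -/
theorem ae_eq_of_markovL2_eq (h : Kernel.Invariant κ μ) {x : Lp ℝ 2 μ}
    (hx : markovL2 h x = x) : ∀ᵐ u ∂μ, ∀ᵐ v ∂κ u, x v = x u := by
  set U := Lp.compMeasurePreservingₗᵢ (E := ℝ) (p := 2) ℝ Prod.snd
    (measurePreserving_snd_compProd h) with hU
  set V := Lp.compMeasurePreservingₗᵢ (E := ℝ) (p := 2) ℝ Prod.fst
    (measurePreserving_fst_compProd (κ := κ) (μ := μ)) with hV
  have h1 : V x = U x := by
    refine eq_of_norm_le_re_inner_eq_norm_sq (𝕜 := ℝ) ?_ ?_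
    · rw [LinearIsometry.norm_map, LinearIsometry.norm_map]
    · rw [← inner_markovL2 h, hx, LinearIsometry.norm_map]
      simp
  have e1 : U x =ᵐ[μ ⊗ₘ κ] x ∘ Prod.snd := Lp.coeFn_compMeasurePreserving _ _
  have e2 : V x =ᵐ[μ ⊗ₘ κ] x ∘ Prod.fst := Lp.coeFn_compMeasurePreserving _ _
  refine Measure.ae_ae_of_ae_compProd (p := fun z => x z.2 = x z.1) ?_
  filter_upwards [e1, e2] with z h3 h4
  rw [h1] at h4
  exact h3.symm.trans h4

/-- Mean ergodic theorem in `L¹` for irreducible kernels. -/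
theorem tendsto_integral_abs_kernelSum (h : Kernel.Invariant κ μ) {φ : Measure T} (hφ : φ ≠ 0)
    (hirr : Kernel.IsIrreducible φ κ) {g : T → ℝ} {c : ℝ} (hg : BddMeasurable c g)
    (hg0 : ∫ x, g x ∂μ = 0) :
    Tendsto (fun k : ℕ => (∫ x, |kernelSum κ k g x| ∂μ) / k) atTop (𝓝 0) := by
  set F := markovL2 h
  have h1 := ContinuousLinearMap.tendsto_birkhoffAverage_orthogonalProjection F
    (norm_markovL2_le h) (hg.memLp.toLp g)
  -- The limit in von Neumann's theorem is the projection onto the fixed vectors. These are almost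
  -- surely constant, and `g` is centred, hence orthogonal to them.
  have h2 : (F.eqLocus (1 : Lp ℝ 2 μ →L[ℝ] Lp ℝ 2 μ)).orthogonalProjectionOnto
      (hg.memLp.toLp g) = 0 := by
    rw [Submodule.orthogonalProjectionOnto_eq_zero_iff]
    intro x hx
    have hx' : markovL2 h x = x := hx
    obtain ⟨a, ha⟩ := exists_ae_eq_const_of_irreducible h hφ hirr
      (Lp.stronglyMeasurable x).measurable (ae_eq_of_markovL2_eq h hx')
    rw [L2.inner_def]
    have : ∀ᵐ u ∂μ, inner ℝ (x u) ((hg.memLp.toLp g : Lp ℝ 2 μ) u) = a * g u := by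
      filter_upwards [ha, hg.memLp.coeFn_toLp] with u h3 h4
      rw [h3, h4]; simp [mul_comm]
    rw [integral_congr_ae this, integral_const_mul, hg0, mul_zero]
  rw [h2] at h1
  have hiter : ∀ j, F^[j] (hg.memLp.toLp g) =
      (hg.iterate (κ := κ) j).memLp.toLp ((kernelAct κ)^[j] g) := by
    intro j
    induction j with
    | zero => rfl
    | succ j ih =>
      rw [Function.iterate_succ_apply', ih, markovL2_toLp h (hg.iterate j)]
      simp only [Function.iterate_succ_apply']
  have hsum : ∀ k : ℕ, (birkhoffAverage ℝ F _root_.id k (hg.memLp.toLp g) : Lp ℝ 2 μ) =ᵐ[μ]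
      fun x => (k : ℝ)⁻¹ * kernelSum κ k g x := by
    intro k
    rw [birkhoffAverage]
    have e : (birkhoffSum F _root_.id k (hg.memLp.toLp g) : Lp ℝ 2 μ) =ᵐ[μ]
        kernelSum κ k g := by
      induction k with
      | zero =>
        have h0 : kernelSum κ 0 g = fun _ => 0 := by funext x; simp [kernelSum]
        rw [birkhoffSum_zero, h0]
        exact Lp.coeFn_zero _ _ _
      | succ k ih =>
        rw [birkhoffSum_succ]
        filter_upwards [ih, (hg.iterate (κ := κ) k).memLp.coeFn_toLp (μ := μ), Lp.coeFn_add
          (birkhoffSum F _root_.id k (hg.memLp.toLp g)) (F^[k] (hg.memLp.toLp g))] with x h3 h4 h5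
        change (birkhoffSum F _root_.id k (hg.memLp.toLp g) + F^[k] (hg.memLp.toLp g) :
          Lp ℝ 2 μ) x = _
        rw [h5, Pi.add_apply, h3, hiter, h4, kernelSum, kernelSum, Finset.sum_range_succ]
    filter_upwards [e, Lp.coeFn_smul (k : ℝ)⁻¹ (birkhoffSum F _root_.id k (hg.memLp.toLp g))]
      with x h3 h4
    rw [h4, Pi.smul_apply, h3, smul_eq_mul]
  have h3 : Tendsto (fun k : ℕ => ‖birkhoffAverage ℝ F _root_.id k (hg.memLp.toLp g)‖) atTop
      (𝓝 0) := by simpa using h1.norm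
  -- On a probability space the `L¹` norm is at most the `L²` norm.
  refine squeeze_zero (fun k => by positivity) (fun k => ?_) h3
  have hk := (hg.kernelSum (κ := κ) k)
  have e1 : (∫ x, |kernelSum κ k g x| ∂μ) / k =
      ∫ x, ‖(birkhoffAverage ℝ F _root_.id k (hg.memLp.toLp g) : Lp ℝ 2 μ) x‖ ∂μ := by
    rw [div_eq_inv_mul, ← integral_const_mul]
    refine integral_congr_ae ?_
    filter_upwards [hsum k] with x hx
    rw [hx, Real.norm_eq_abs, abs_mul, abs_of_nonneg (by positivity : (0 : ℝ) ≤ (k : ℝ)⁻¹)]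
  set y : Lp ℝ 2 μ := birkhoffAverage ℝ F _root_.id k (hg.memLp.toLp g)
  rw [e1, integral_norm_eq_lintegral_enorm (Lp.aestronglyMeasurable y), Lp.norm_def,
    ← eLpNorm_one_eq_lintegral_enorm]
  exact ENNReal.toReal_mono (Lp.eLpNorm_ne_top y)
    (eLpNorm_le_eLpNorm_of_exponent_le one_le_two (Lp.aestronglyMeasurable y))

end Ergodic

/-! ### Two-time marginals of a stationary trajectory -/

section Trajectory

variable {Y : Type*} [MeasurableSpace Y] (η : Kernel Y Y) [IsMarkovKernel η]
  (μ : Measure Y)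

/-- The law of the time-homogeneous Markov chain with initial law `μ` and transition
kernel `η`. -/
noncomputable def markovChainLaw : Measure (ℕ → Y) :=
  Kernel.trajMeasure (X := fun _ : ℕ => Y) μ
    (fun n => η.comap (fun h => h ⟨n, Finset.mem_Iic.2 le_rfl⟩) (measurable_pi_apply _))

instance [IsProbabilityMeasure μ] : IsProbabilityMeasure (markovChainLaw η μ) := by
  unfold markovChainLaw; infer_instance

theorem markovChainLaw_map_zero : (markovChainLaw η μ).map (fun ω => ω 0) = μ := by
  have h : (fun ω : ℕ → Y => ω 0) =
      (fun z : Finset.Iic 0 → Y => z ⟨0, Finset.mem_Iic.2 le_rfl⟩) ∘ Preorder.frestrictLe 0 := rfl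
  have hm : Measurable (fun z : Finset.Iic 0 → Y => z ⟨0, Finset.mem_Iic.2 le_rfl⟩) :=
    measurable_pi_apply _
  rw [h, ← Measure.map_map hm (by fun_prop), markovChainLaw, Kernel.trajMeasure,
    Measure.map_comp _ _ (by fun_prop), Kernel.traj_map_frestrictLe, Kernel.partialTraj_self,
    Measure.id_comp, Measure.map_map hm (by fun_prop)]
  exact Measure.map_id

variable {η μ} [IsProbabilityMeasure μ] {f g : Y → ℝ} {c c' : ℝ}

/-- The Markov property at time `n`: the history up to `n` and the next state have as joint law the
composition of the law of the history with `η`, read at the last coordinate only. -/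
theorem integral_mul_succ_markovChainLaw (hf : BddMeasurable c f) (hg : BddMeasurable c' g)
    {i n : ℕ} (hi : i ≤ n) :
    ∫ ω, f (ω i) * g (ω (n + 1)) ∂markovChainLaw η μ =
      ∫ ω, f (ω i) * kernelAct η g (ω n) ∂markovChainLaw η μ := by
  have h := Kernel.map_frestrictLe_trajMeasure_compProd_eq_map_trajMeasure (X := fun _ : ℕ => Y)
    (μ₀ := μ) (κ := fun n => η.comap (fun h => h ⟨n, Finset.mem_Iic.2 le_rfl⟩)
      (measurable_pi_apply _)) (a := n)
  have hF : BddMeasurable (c * c') (fun z : (Finset.Iic n → Y) × Y =>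
      f (z.1 ⟨i, Finset.mem_Iic.2 hi⟩) * g z.2) :=
    (hf.comp (by fun_prop : Measurable fun z : (Finset.Iic n → Y) × Y =>
      z.1 ⟨i, Finset.mem_Iic.2 hi⟩)).mul (hg.comp measurable_snd)
  have hmap : Measurable (fun x : ℕ → Y => (Preorder.frestrictLe (π := fun _ => Y) n x, x (n + 1))) := by
    fun_prop
  have hG : Measurable (fun z : Finset.Iic n → Y => f (z ⟨i, Finset.mem_Iic.2 hi⟩) *
      kernelAct η g (z ⟨n, Finset.mem_Iic.2 le_rfl⟩)) :=
    (hf.1.comp (measurable_pi_apply _)).mul (hg.act.1.comp (measurable_pi_apply _))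
  have e1 : ∫ ω, f (ω i) * g (ω (n + 1)) ∂markovChainLaw η μ = ∫ z,
      f (z.1 ⟨i, Finset.mem_Iic.2 hi⟩) * g z.2 ∂((markovChainLaw η μ).map
        (fun x : ℕ → Y => (Preorder.frestrictLe (π := fun _ => Y) n x, x (n + 1)))) := by
    rw [integral_map hmap.aemeasurable hF.1.aestronglyMeasurable]
    rfl
  have : IsProbabilityMeasure
      ((markovChainLaw η μ).map (Preorder.frestrictLe (π := fun _ => Y) n)) :=
    Measure.isProbabilityMeasure_map (by fun_prop)
  rw [e1]
  unfold markovChainLaw at *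
  rw [← h, Measure.integral_compProd (hF.integrable _)]
  simp_rw [integral_const_mul]
  exact integral_map (by fun_prop) hG.aestronglyMeasurable

theorem integral_mul_add_markovChainLaw (hf : BddMeasurable c f) (hg : BddMeasurable c' g)
    (i j : ℕ) :
    ∫ ω, f (ω i) * g (ω (i + j)) ∂markovChainLaw η μ =
      ∫ ω, f (ω i) * (kernelAct η)^[j] g (ω i) ∂markovChainLaw η μ := by
  induction j generalizing g with
  | zero => rfl
  | succ j ih =>
    rw [← add_assoc, integral_mul_succ_markovChainLaw hf hg (Nat.le_add_right i j), ih hg.act]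
    rfl

theorem integral_markovChainLaw (h : Kernel.Invariant η μ) (hf : BddMeasurable c f) (i : ℕ) :
    ∫ ω, f (ω i) ∂markovChainLaw η μ = ∫ y, f y ∂μ := by
  -- With the constant `1` in the first slot, the two-time formula from time `0` gives the one-time
  -- marginal.
  have h1 := integral_mul_add_markovChainLaw (η := η) (μ := μ) (f := fun _ => 1) (c := 1)
    ⟨measurable_const, by simp⟩ hf 0 i
  simp only [one_mul, zero_add] at h1
  rw [h1]
  have h2 : ∀ j, ∫ y, (kernelAct η)^[j] f y ∂μ = ∫ y, f y ∂μ := by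
    intro j
    induction j with
    | zero => rfl
    | succ j ih => rw [Function.iterate_succ_apply', integral_kernelAct h (hf.iterate j), ih]
  rw [← h2 i]
  conv_rhs => rw [← markovChainLaw_map_zero η μ]
  rw [integral_map (measurable_pi_apply 0).aemeasurable (hf.iterate i).1.aestronglyMeasurable]

theorem integral_mul_markovChainLaw (h : Kernel.Invariant η μ) (hf : BddMeasurable c f)
    (hg : BddMeasurable c' g) (i j : ℕ) :
    ∫ ω, f (ω i) * g (ω (i + j)) ∂markovChainLaw η μ =
      ∫ y, f y * (kernelAct η)^[j] g y ∂μ := by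
  rw [integral_mul_add_markovChainLaw hf hg, integral_markovChainLaw h (hf.mul (hg.iterate j))]

end Trajectory

/-! ### Metropolis--Hastings chains -/

section MetropolisKernel

variable {α β : Type*} [MeasurableSpace α] [MeasurableSpace β]

theorem measurable_uncurry_accept {A : α → β → β → unitInterval}
    (hA : Measurable fun z : (α × β) × β => A z.1.1 z.1.2 z.2) :
    Measurable (Function.uncurry fun (z : α × β) (v : β) => ENNReal.ofReal (A z.1 z.2 v)) :=
  ENNReal.measurable_ofReal.comp (measurable_subtype_coe.comp hA)

theorem metropolisKernel_apply (Q : Kernel (α × β) β) [IsMarkovKernel Q]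
    {A : α → β → β → unitInterval} (hA : Measurable fun z : (α × β) × β => A z.1.1 z.1.2 z.2)
    (z : α × β) : metropolisKernel Q A z =
      (Q z).withDensity (fun v => ENNReal.ofReal (A z.1 z.2 v)) +
      (1 - ∫⁻ v, ENNReal.ofReal (A z.1 z.2 v) ∂(Q z)) • Measure.dirac z.2 := by
  have h1 := measurable_uncurry_accept hA
  have h2 : Measurable (Function.uncurry fun (z : α × β) (_ : β) =>
      1 - ∫⁻ v, ENNReal.ofReal (A z.1 z.2 v) ∂(Q z)) :=
    (measurable_const.sub (Measurable.lintegral_kernel_prod_right h1)).comp measurable_fst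
  rw [metropolisKernel, add_apply, Kernel.withDensity_apply _ h1, Kernel.withDensity_apply _ h2,
    withDensity_const, Kernel.deterministic_apply]

theorem lintegral_accept_le_one (Q : Kernel (α × β) β) [IsMarkovKernel Q]
    (A : α → β → β → unitInterval) (z : α × β) :
    ∫⁻ v, ENNReal.ofReal (A z.1 z.2 v) ∂(Q z) ≤ 1 :=
  calc ∫⁻ v, ENNReal.ofReal (A z.1 z.2 v) ∂(Q z) ≤ ∫⁻ _, 1 ∂(Q z) :=
        lintegral_mono fun v => ENNReal.ofReal_le_one.2 (A z.1 z.2 v).2.2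
    _ = 1 := by simp

theorem BddMeasurable.accept {γ : Type*} [MeasurableSpace γ] {A : γ → unitInterval}
    (hA : Measurable A) : BddMeasurable 1 (fun v => (A v : ℝ)) :=
  ⟨measurable_subtype_coe.comp hA, fun v => by rw [abs_of_nonneg (A v).2.1]; exact (A v).2.2⟩

/-- The Metropolis kernel acts by `h ↦ h(u) + ∫ A(u, v) (h(v) - h(u)) Q(u, dv)`. -/
theorem kernelAct_metropolisKernel (Q : Kernel (α × β) β) [IsMarkovKernel Q]
    {A : α → β → β → unitInterval} (hA : Measurable fun z : (α × β) × β => A z.1.1 z.1.2 z.2)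
    {h : β → ℝ} {c : ℝ} (hh : BddMeasurable c h) (a : α) (u : β) :
    kernelAct ((metropolisKernel Q A).sectR a) h u =
      h u + ∫ v, A a u v * (h v - h u) ∂(Q.sectR a u) := by
  have := isMarkovKernel_metropolisKernel Q A hA
  have hAu : Measurable (fun v => A a u v) := hA.comp (by fun_prop : Measurable fun v => ((a, u), v))
  have hAb := BddMeasurable.accept hAu
  have hm : Measurable fun v => ENNReal.ofReal (A a u v) := hAb.1.ennreal_ofReal
  have hint : Integrable h (metropolisKernel Q A (a, u)) := hh.integrable _
  have hI : ∫⁻ v, ENNReal.ofReal (A a u v) ∂(Q (a, u)) =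
      ENNReal.ofReal (∫ v, (A a u v : ℝ) ∂(Q (a, u))) :=
    (ofReal_integral_eq_lintegral_ofReal (hAb.integrable _)
      (ae_of_all _ fun v => (A a u v).2.1)).symm
  have h0 : 0 ≤ ∫ v, (A a u v : ℝ) ∂(Q (a, u)) := integral_nonneg fun v => (A a u v).2.1
  have h1 : ∫ v, (A a u v : ℝ) ∂(Q (a, u)) ≤ 1 :=
    (le_abs_self _).trans (hAb.abs_integral_le)
  change ∫ v, h v ∂(metropolisKernel Q A (a, u)) = h u + ∫ v, A a u v * (h v - h u) ∂(Q (a, u))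
  rw [metropolisKernel_apply Q hA] at hint ⊢
  rw [integral_add_measure (hint.mono_measure (Measure.le_add_right le_rfl))
    (hint.mono_measure (Measure.le_add_left le_rfl)),
    integral_withDensity_eq_integral_toReal_smul hm (ae_of_all _ fun _ => ENNReal.ofReal_lt_top),
    integral_smul_measure, integral_dirac' _ _ hh.1.stronglyMeasurable, hI]
  have e1 : (1 - ENNReal.ofReal (∫ v, (A a u v : ℝ) ∂(Q (a, u)))).toReal =
      1 - ∫ v, (A a u v : ℝ) ∂(Q (a, u)) := by
    rw [← ENNReal.ofReal_one, ← ENNReal.ofReal_sub _ h0, ENNReal.toReal_ofReal (by linarith)]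
  have e2 : ∀ v, (ENNReal.ofReal (A a u v)).toReal = A a u v := fun v =>
    ENNReal.toReal_ofReal (A a u v).2.1
  simp_rw [e2, mul_sub]
  rw [integral_sub ((hAb.mul hh).integrable _) ((hAb.integrable _).mul_const _),
    integral_mul_const, e1]
  simp only [smul_eq_mul]
  ring

end MetropolisKernel

namespace MetropolisHastings

variable {𝒳 T : Type*} [MeasurableSpace 𝒳] [MeasurableSpace T] (M : MetropolisHastings 𝒳 T)

/-- By detailed balance the accepted flow `Γ` is symmetric, so as much mass enters `B` as leaves it;
rejected moves do not displace mass. -/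
theorem invariant_kernel (x : 𝒳) : Kernel.Invariant (M.kernel.sectR x) (M.target x) := by
  ext B hB
  rw [Measure.bind_apply hB (Kernel.aemeasurable _)]
  set Γ := (M.target x ⊗ₘ M.proposal.sectR x).withDensity
    fun z => ENNReal.ofReal (M.accept x z.1 z.2) with hΓ
  have hAm : Measurable fun z : T × T => ENNReal.ofReal (M.accept x z.1 z.2) :=
    (measurable_uncurry_accept M.measurable_accept).comp
      (by fun_prop : Measurable fun z : T × T => ((x, z.1), z.2))
  have hΓap : ∀ S, MeasurableSet S → Γ S = ∫⁻ u, ∫⁻ v in Prod.mk u ⁻¹' S,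
      ENNReal.ofReal (M.accept x u v) ∂(M.proposal (x, u)) ∂(M.target x) := by
    intro S hS
    rw [hΓ, withDensity_apply _ hS, ← lintegral_indicator hS,
      Measure.lintegral_compProd (hAm.indicator hS)]
    refine lintegral_congr fun u => ?_
    rw [← lintegral_indicator (measurable_prodMk_left hS)]
    rfl
  have hsymm : Γ (Set.univ ×ˢ B) = Γ (B ×ˢ Set.univ) := by
    conv_lhs => rw [hΓ, ← M.balance x]
    rw [Measure.map_apply measurable_swap (MeasurableSet.univ.prod hB), Set.preimage_swap_prod]
  have h1 : Γ (Set.univ ×ˢ B) = ∫⁻ u, ∫⁻ v in B, ENNReal.ofReal (M.accept x u v)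
      ∂(M.proposal (x, u)) ∂(M.target x) := by
    rw [hΓap _ (MeasurableSet.univ.prod hB)]
    simp
  have h2 : Γ (B ×ˢ Set.univ) = ∫⁻ u, B.indicator (fun u => ∫⁻ v, ENNReal.ofReal (M.accept x u v)
      ∂(M.proposal (x, u))) u ∂(M.target x) := by
    rw [hΓap _ (hB.prod MeasurableSet.univ)]
    refine lintegral_congr fun u => ?_
    by_cases hu : u ∈ B <;> simp [hu]
  have hfin : Γ (B ×ˢ Set.univ) ≠ ∞ := by
    refine ne_top_of_le_ne_top ENNReal.one_ne_top ?_
    calc _ ≤ ∫⁻ u, 1 ∂(M.target x) := by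
          rw [h2]
          refine lintegral_mono fun u => (Set.indicator_le_self' (fun _ _ => zero_le) u).trans ?_
          exact lintegral_accept_le_one M.proposal M.accept (x, u)
      _ = 1 := by simp
  -- The subtracted part of the rejection mass is moved to the other side, so that no truncated
  -- subtraction is integrated. After integration the two terms in `Γ` are equal and finite, and
  -- cancel.
  have hpt : ∀ u, M.kernel.sectR x u B + B.indicator (fun u => ∫⁻ v,
      ENNReal.ofReal (M.accept x u v) ∂(M.proposal (x, u))) u =
      (∫⁻ v in B, ENNReal.ofReal (M.accept x u v) ∂(M.proposal (x, u))) +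
        B.indicator 1 u := by
    intro u
    have hle := lintegral_accept_le_one M.proposal M.accept (x, u)
    change metropolisKernel M.proposal M.accept (x, u) B + _ = _
    rw [metropolisKernel_apply _ M.measurable_accept, Measure.add_apply, withDensity_apply _ hB,
      Measure.smul_apply, Measure.dirac_apply' _ hB, add_assoc]
    congr 1
    by_cases hu : u ∈ B
    · simp only [hu, Set.indicator_of_mem, Pi.one_apply, smul_eq_mul, mul_one]
      exact tsub_add_cancel_of_le hle
    · simp [hu]
  have hmeas : Measurable fun u => B.indicator (fun u => ∫⁻ v,
      ENNReal.ofReal (M.accept x u v) ∂(M.proposal (x, u))) u := by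
    refine Measurable.indicator ?_ hB
    exact (Measurable.lintegral_kernel_prod_right
      (measurable_uncurry_accept M.measurable_accept)).comp measurable_prodMk_left
  have htot := lintegral_congr (μ := M.target x) hpt
  rw [lintegral_add_right _ hmeas, lintegral_add_right _ (measurable_one.indicator hB), ← h1, ← h2,
    hsymm, lintegral_indicator_one hB, add_comm] at htot
  exact (ENNReal.add_right_inj hfin).1 htot

/-- For fixed data the pair (data, state) is a homogeneous Markov chain whose first coordinate stays
at `x`; this gives access to the formulas for `markovChainLaw`. -/
theorem chain_apply (x : 𝒳) : M.chain x =
    (markovChainLaw M.step ((M.target x).map (Prod.mk x))).map (fun ω m => (ω m).2) := by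
  have hm : Measurable fun (ω : ℕ → 𝒳 × T) m => (ω m).2 := by fun_prop
  have hc : Measurable fun (z : 𝒳 × T) (_ : Finset.Iic 0) => z := by fun_prop
  rw [chain, Kernel.map_apply _ hm, Kernel.comp_apply, Kernel.map_apply _ hc, Kernel.prod_apply,
    Kernel.id_apply, Measure.dirac_prod]
  rfl

instance : IsMarkovKernel M.chain := by
  refine ⟨fun x => ?_⟩
  rw [chain_apply]
  have : IsProbabilityMeasure ((M.target x).map (Prod.mk x)) :=
    Measure.isProbabilityMeasure_map measurable_prodMk_left.aemeasurable
  have hm : Measurable fun (ω : ℕ → 𝒳 × T) m => (ω m).2 := by fun_prop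
  exact Measure.isProbabilityMeasure_map hm.aemeasurable

theorem step_apply (x : 𝒳) (u : T) : M.step (x, u) = (M.kernel (x, u)).map (Prod.mk x) := by
  rw [step, Kernel.prod_apply, Kernel.deterministic_apply, Measure.dirac_prod]

theorem kernelAct_step (x : 𝒳) {f : 𝒳 × T → ℝ} (hf : Measurable f) (u : T) :
    kernelAct M.step f (x, u) = kernelAct (M.kernel.sectR x) (fun v => f (x, v)) u := by
  rw [kernelAct, step_apply, integral_map measurable_prodMk_left.aemeasurable
    hf.aestronglyMeasurable]
  rfl

theorem iterate_kernelAct_step (x : 𝒳) {f : 𝒳 × T → ℝ} {c : ℝ} (hf : BddMeasurable c f) (j : ℕ)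
    (u : T) : (kernelAct M.step)^[j] f (x, u) =
      (kernelAct (M.kernel.sectR x))^[j] (fun v => f (x, v)) u := by
  induction j generalizing u with
  | zero => rfl
  | succ j ih =>
    rw [Function.iterate_succ_apply', Function.iterate_succ_apply',
      kernelAct_step _ _ (hf.iterate j).1]
    simp_rw [ih]

theorem invariant_step (x : 𝒳) : Kernel.Invariant M.step ((M.target x).map (Prod.mk x)) := by
  ext B hB
  rw [Measure.bind_apply hB (Kernel.aemeasurable _),
    lintegral_map (M.step.measurable_coe hB) measurable_prodMk_left,
    Measure.map_apply measurable_prodMk_left hB]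
  conv_rhs => rw [← (M.invariant_kernel x).def]
  rw [Measure.bind_apply (measurable_prodMk_left hB) (Kernel.aemeasurable _)]
  refine lintegral_congr fun u => ?_
  rw [step_apply, Measure.map_apply measurable_prodMk_left hB]
  rfl

/-- The two-time marginals of the stationary chain. -/
theorem integral_mul_chain (x : 𝒳) {f g : T → ℝ} {c c' : ℝ} (hf : BddMeasurable c f)
    (hg : BddMeasurable c' g) (i j : ℕ) :
    ∫ θ, f (θ i) * g (θ (i + j)) ∂(M.chain x) =
      ∫ u, f u * (kernelAct (M.kernel.sectR x))^[j] g u ∂(M.target x) := by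
  have : IsProbabilityMeasure ((M.target x).map (Prod.mk x)) :=
    Measure.isProbabilityMeasure_map measurable_prodMk_left.aemeasurable
  have hf' := hf.comp (measurable_snd (α := 𝒳) (β := T))
  have hg' := hg.comp (measurable_snd (α := 𝒳) (β := T))
  have hm : Measurable fun (ω : ℕ → 𝒳 × T) m => (ω m).2 := by fun_prop
  have hfg : Measurable fun θ : ℕ → T => f (θ i) * g (θ (i + j)) :=
    (hf.1.comp (measurable_pi_apply _)).mul (hg.1.comp (measurable_pi_apply _))
  rw [chain_apply, integral_map hm.aemeasurable hfg.aestronglyMeasurable]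
  refine (integral_mul_markovChainLaw (M.invariant_step x) hf' hg' i j).trans ?_
  rw [integral_map measurable_prodMk_left.aemeasurable
    (hf'.mul (hg'.iterate j)).1.aestronglyMeasurable]
  simp_rw [iterate_kernelAct_step _ _ hg']
  rfl

end MetropolisHastings

/-! ### Comparison of two Markov kernels in `L¹` -/

section Comparison

variable {T E : Type*} [MeasurableSpace T] [MeasurableSpace E] {κ' : Kernel T T} {κ : Kernel E E}
  [IsMarkovKernel κ'] [IsMarkovKernel κ] {μ' : Measure T} {μ : Measure E}
  [IsProbabilityMeasure μ'] {l : T → E} {a δ : ℝ}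

/-- Scaling of a bound over functions with values in `[-1, 1]`. -/
theorem abs_sub_le_of_bddMeasurable {Y : Type*} [MeasurableSpace Y] {I J : (Y → ℝ) → ℝ}
    (hI : ∀ (c : ℝ) f, I (fun y => c * f y) = c * I f)
    (hJ : ∀ (c : ℝ) f, J (fun y => c * f y) = c * J f)
    (h : ∀ f, BddMeasurable 1 f → |I f - J f| ≤ a) {c : ℝ} (hc : 0 < c) {f : Y → ℝ}
    (hf : BddMeasurable c f) : |I f - J f| ≤ c * a := by
  have h1 : BddMeasurable 1 (fun y => c⁻¹ * f y) := by
    refine ⟨hf.1.const_mul _, fun y => ?_⟩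
    rw [abs_mul, abs_inv, abs_of_pos hc, inv_mul_le_one₀ hc]
    exact hf.2 y
  have h2 := h _ h1
  rw [hI, hJ, ← mul_sub, abs_mul, abs_inv, abs_of_pos hc, inv_mul_le_iff₀ hc] at h2
  exact h2

/-- One-step comparison of Metropolis-type kernels. -/
theorem integral_abs_kernelAct_sub_le [IsProbabilityMeasure μ] {Q' : Kernel T T} {Q : Kernel E E} [IsMarkovKernel Q']
    [IsMarkovKernel Q] {A' : T × T → ℝ} {A : E × E → ℝ} (hA' : BddMeasurable 1 A')
    (hA : BddMeasurable 1 A) (hl : MeasurableEmbedding l)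
    (hκ' : ∀ h, BddMeasurable 1 h → ∀ u, kernelAct κ' h u =
      h u + ∫ v, A' (u, v) * (h v - h u) ∂(Q' u))
    (hκ : ∀ h, BddMeasurable 1 h → ∀ u, kernelAct κ h u =
      h u + ∫ v, A (u, v) * (h v - h u) ∂(Q u))
    (h1 : ∀ F : E × E → ℝ, BddMeasurable 1 F →
      |∫ z, F (Prod.map l l z) ∂(μ' ⊗ₘ Q') - ∫ z, F z ∂(μ ⊗ₘ Q)| ≤ a)
    (h2 : ∀ F : E × E → ℝ, BddMeasurable 1 F →
      |∫ z, A' z * F (Prod.map l l z) ∂(μ' ⊗ₘ Q') - ∫ z, A z * F z ∂(μ ⊗ₘ Q)| ≤ a)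
    {h : E → ℝ} (hh : BddMeasurable 1 h) :
    ∫ u, |kernelAct κ' (h ∘ l) u - kernelAct κ h (l u)| ∂μ' ≤ 4 * a := by
  have hhl := hh.comp hl.measurable
  -- the two increments
  set I' : T → ℝ := fun u => kernelAct κ' (h ∘ l) u - h (l u) with hI'
  set I : E → ℝ := fun y => kernelAct κ h y - h y with hI
  have hI'b : BddMeasurable 2 I' := by
    have := hhl.act (κ := κ').sub hhl; norm_num at this; exact this
  have hIb : BddMeasurable 2 I := by
    have := hh.act (κ := κ).sub hh; norm_num at this; exact this
  -- the sign of the difference, as a function on `E`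
  set B : Set T := {u | I (l u) ≤ I' u} with hB
  -- The sign must be a function of the coordinate in `E`, because the hypotheses test only such
  -- functions. This is where `l` has to be a measurable embedding.
  have hBm : MeasurableSet (l '' B) := hl.measurableSet_image.2
    (measurableSet_le (hIb.1.comp hl.measurable) hI'b.1)
  classical
  set φ : E → ℝ := fun y => if y ∈ l '' B then 1 else -1 with hφ
  have hφb : BddMeasurable 1 φ := by
    refine ⟨Measurable.ite hBm measurable_const measurable_const, fun y => ?_⟩
    simp only [hφ]
    split_ifs <;> simp
  have hsign : ∀ u, |kernelAct κ' (h ∘ l) u - kernelAct κ h (l u)| =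
      φ (l u) * I' u - φ (l u) * I (l u) := by
    intro u
    have e : kernelAct κ' (h ∘ l) u - kernelAct κ h (l u) = I' u - I (l u) := by
      simp only [hI', hI]; ring
    rw [e]
    by_cases hu : I (l u) ≤ I' u
    · have : φ (l u) = 1 := if_pos ⟨u, hu, rfl⟩
      rw [abs_of_nonneg (sub_nonneg.2 hu), this]; ring
    · have : φ (l u) = -1 := if_neg fun ⟨w, hw, hwu⟩ => hu (hl.injective hwu ▸ hw)
      rw [abs_of_nonpos (by linarith), this]; ring
  have hφl := hφb.comp hl.measurable
  have hφI' := hφl.mul hI'b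
  have hφI := hφb.mul hIb
  -- the test function on pairs
  set G : E × E → ℝ := fun z => φ z.1 * (h z.2 - h z.1) with hG
  have hGb : BddMeasurable 2 G := by
    have := (hφb.comp measurable_fst).mul
      ((hh.comp (measurable_snd (α := E))).sub (hh.comp (measurable_fst (β := E))))
    norm_num at this; exact this
  have e1 : ∫ u, φ (l u) * I' u ∂μ' = ∫ z, A' z * G (Prod.map l l z) ∂(μ' ⊗ₘ Q') := by
    have hint : Integrable (fun z => A' z * G (Prod.map l l z)) (μ' ⊗ₘ Q') :=
      (hA'.mul (hGb.comp (hl.measurable.prodMap hl.measurable))).integrable _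
    rw [Measure.integral_compProd hint]
    congr 1; funext u
    simp only [hI']
    rw [hκ' _ hhl, Function.comp_apply, add_sub_cancel_left, ← integral_const_mul]
    congr 1; funext v
    simp only [hG, Prod.map_fst, Prod.map_snd, Function.comp_apply]
    ring
  have e2 : ∫ y, φ y * I y ∂μ = ∫ z, A z * G z ∂(μ ⊗ₘ Q) := by
    have hint := (hA.mul hGb).integrable (μ ⊗ₘ Q)
    rw [Measure.integral_compProd hint]
    congr 1; funext u
    simp only [hI]
    rw [hκ _ hh, add_sub_cancel_left, ← integral_const_mul]
    congr 1; funext v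
    simp only [hG]
    ring
  -- Both test functions, `G` and `φ I`, are bounded by `2`. So `2a` is spent on the accepted
  -- increments and `2a` on replacing `μ'` by `μ`.
  have b1 := abs_sub_le_of_bddMeasurable (c := 2)
    (I := fun F => ∫ z, A' z * F (Prod.map l l z) ∂(μ' ⊗ₘ Q'))
    (J := fun F => ∫ z, A z * F z ∂(μ ⊗ₘ Q))
    (fun c f => by rw [← integral_const_mul]; congr 1; funext z; ring)
    (fun c f => by rw [← integral_const_mul]; congr 1; funext z; ring) h2 two_pos hGb
  have b2 := abs_sub_le_of_bddMeasurable (c := 2)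
    (I := fun F => ∫ z, F (Prod.map l l z) ∂(μ' ⊗ₘ Q')) (J := fun F => ∫ z, F z ∂(μ ⊗ₘ Q))
    (fun c f => integral_const_mul _ _) (fun c f => integral_const_mul _ _) h1 two_pos
    (f := fun z => φ z.1 * I z.1)
    (by have := hφI.comp (measurable_fst (β := E)); norm_num at this; exact this)
  have e3 : ∫ z, φ (Prod.map l l z).1 * I (Prod.map l l z).1 ∂(μ' ⊗ₘ Q') =
      ∫ u, φ (l u) * I (l u) ∂μ' := by
    have hint := ((hφI.comp hl.measurable).comp (measurable_fst (β := T))).integrable (μ' ⊗ₘ Q')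
    refine (Measure.integral_compProd hint).trans ?_
    simp
  have e4 : ∫ z, φ z.1 * I z.1 ∂(μ ⊗ₘ Q) = ∫ y, φ y * I y ∂μ := by
    have hint := (hφI.comp (measurable_fst (β := E))).integrable (μ ⊗ₘ Q)
    refine (Measure.integral_compProd hint).trans ?_
    simp
  simp_rw [hsign]
  have hi1 : Integrable (fun u => φ (l u) * I' u) μ' := hφI'.integrable _
  have hi2 : Integrable (fun u => φ (l u) * I (l u)) μ' := (hφI.comp hl.measurable).integrable _
  rw [integral_sub hi1 hi2]
  rw [← e1, ← e2] at b1
  rw [e3, e4] at b2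
  have := (abs_le.1 b1).2
  have := (abs_le.1 b2).1
  linarith

/-- Telescoping: the error after `j + 1` steps is `κ'` applied to the error after `j` steps, which
is a contraction in `L¹(μ')`, plus a one-step error for the test function `κ^j h`, still bounded by
`1`. -/
theorem integral_abs_iterate_sub_le (hinv : Kernel.Invariant κ' μ') (hl : Measurable l)
    (hδ : ∀ h : E → ℝ, BddMeasurable 1 h →
      ∫ u, |kernelAct κ' (h ∘ l) u - kernelAct κ h (l u)| ∂μ' ≤ δ)
    {h : E → ℝ} (hh : BddMeasurable 1 h) (j : ℕ) :
    ∫ u, |(kernelAct κ')^[j] (h ∘ l) u - (kernelAct κ)^[j] h (l u)| ∂μ' ≤ j * δ := by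
  induction j with
  | zero => simp
  | succ j ih =>
    have b1 := (hh.comp hl).iterate (κ := κ') j
    have b2 := (hh.iterate (κ := κ) j).comp hl
    have b3 := hh.iterate (κ := κ) j
    have e1 := integral_abs_kernelAct_le hinv (b1.sub b2)
    rw [kernelAct_sub b1 b2] at e1
    have e2 := hδ _ b3
    have i1 := ((b1.act (κ := κ')).sub (b2.act (κ := κ'))).abs
    have i2 := ((b2.act (κ := κ')).sub ((b3.act (κ := κ)).comp hl)).abs
    simp only [Function.iterate_succ_apply']
    calc _ ≤ ∫ u, (|kernelAct κ' ((kernelAct κ')^[j] (h ∘ l)) u -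
            kernelAct κ' ((kernelAct κ)^[j] h ∘ l) u| +
          |kernelAct κ' ((kernelAct κ)^[j] h ∘ l) u -
            kernelAct κ ((kernelAct κ)^[j] h) (l u)|) ∂μ' :=
          integral_mono (((b1.act (κ := κ')).sub ((b3.act (κ := κ)).comp hl)).abs.integrable _)
            ((i1.add i2).integrable _) fun u => abs_sub_le _ _ _
      _ = _ + _ := integral_add (i1.integrable _) (i2.integrable _)
      _ ≤ j * δ + δ := add_le_add (e1.trans ih) e2
      _ = _ := by push_cast; ring

/-- Comparison of the ergodic averages of two kernels. -/
theorem integral_abs_kernelSum_comp_le (hinv : Kernel.Invariant κ' μ') (hl : Measurable l)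
    (hδ : ∀ h : E → ℝ, BddMeasurable 1 h →
      ∫ u, |kernelAct κ' (h ∘ l) u - kernelAct κ h (l u)| ∂μ' ≤ δ)
    (ha : ∀ h : E → ℝ, BddMeasurable 1 h → |∫ u, h (l u) ∂μ' - ∫ y, h y ∂μ| ≤ a)
    {h : E → ℝ} (hh : BddMeasurable 1 h) {k : ℕ} (hk : 0 < k) :
    (∫ u, |kernelSum κ' k (h ∘ l) u| ∂μ') / k ≤
      (∫ y, |kernelSum κ k h y| ∂μ) / k + a + k * δ := by
  have hk' : (0 : ℝ) < k := by exact_mod_cast hk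
  have hδ0 : 0 ≤ δ := (integral_nonneg fun _ => abs_nonneg _).trans (hδ _ hh)
  have s1 := (hh.comp hl).kernelSum (κ := κ') k
  have s2 := hh.kernelSum (κ := κ) k
  have s3 := s2.comp hl
  have d : ∀ j, BddMeasurable (1 + 1)
      (fun u => |(kernelAct κ')^[j] (h ∘ l) u - (kernelAct κ)^[j] h (l u)|) := fun j =>
    (((hh.comp hl).iterate (κ := κ') j).sub ((hh.iterate (κ := κ) j).comp hl)).abs
  have b1 : ∫ u, |kernelSum κ' k (h ∘ l) u| ∂μ' ≤
      ∫ u, |kernelSum κ k h (l u)| ∂μ' + ∑ j ∈ Finset.range k, j * δ := by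
    calc ∫ u, |kernelSum κ' k (h ∘ l) u| ∂μ'
        ≤ ∫ u, (|kernelSum κ k h (l u)| + ∑ j ∈ Finset.range k,
            |(kernelAct κ')^[j] (h ∘ l) u - (kernelAct κ)^[j] h (l u)|) ∂μ' := by
          refine integral_mono (s1.abs.integrable _) (Integrable.add (s3.abs.integrable _)
            (integrable_finsetSum _ fun j _ => (d j).integrable _)) fun u => ?_
          have e : kernelSum κ' k (h ∘ l) u = kernelSum κ k h (l u) + ∑ j ∈ Finset.range k,
              ((kernelAct κ')^[j] (h ∘ l) u - (kernelAct κ)^[j] h (l u)) := by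
            rw [kernelSum, kernelSum, ← Finset.sum_add_distrib]
            exact Finset.sum_congr rfl fun _ _ => by ring
          simp only
          rw [e]
          exact (abs_add_le _ _).trans (add_le_add le_rfl (Finset.abs_sum_le_sum_abs _ _))
      _ = ∫ u, |kernelSum κ k h (l u)| ∂μ' + ∑ j ∈ Finset.range k,
            ∫ u, |(kernelAct κ')^[j] (h ∘ l) u - (kernelAct κ)^[j] h (l u)| ∂μ' := by
          have hi1 : Integrable (fun u => |kernelSum κ k h (l u)|) μ' := s3.abs.integrable _
          rw [integral_add hi1 (integrable_finsetSum _ fun j _ => (d j).integrable _),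
            integral_finsetSum _ fun j _ => (d j).integrable _]
      _ ≤ _ := by
          gcongr with j _
          exact integral_abs_iterate_sub_le hinv hl hδ hh j
  -- A crude bound suffices, since `k` will be fixed before `δ` is made small.
  have b2 : ∑ j ∈ Finset.range k, (j : ℝ) * δ ≤ k * (k * δ) := by
    calc ∑ j ∈ Finset.range k, (j : ℝ) * δ ≤ ∑ j ∈ Finset.range k, (k : ℝ) * δ := by
          refine Finset.sum_le_sum fun j hj => ?_
          have : (j : ℝ) ≤ k := by exact_mod_cast (Finset.mem_range.1 hj).le
          gcongr
      _ = _ := by rw [Finset.sum_const, Finset.card_range, nsmul_eq_mul]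
  have b3 := abs_sub_le_of_bddMeasurable (I := fun f : E → ℝ => ∫ u, f (l u) ∂μ')
    (J := fun f => ∫ y, f y ∂μ) (fun c f => integral_const_mul _ _)
    (fun c f => integral_const_mul _ _) ha hk'
    (f := fun y => |kernelSum κ k h y|) (by simpa using s2.abs)
  have b4 := (abs_le.1 b3).2
  rw [div_le_iff₀ hk']
  have : ((∫ y, |kernelSum κ k h y| ∂μ) / k + a + k * δ) * k =
    (∫ y, |kernelSum κ k h y| ∂μ) + k * a + k * (k * δ) := by field_simp
  rw [this]
  linarith

theorem kernelSum_sub_const {f : T → ℝ} {c : ℝ} (hf : BddMeasurable c f) (b : ℝ) (k : ℕ) (u : T) :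
    kernelSum κ' k (fun x => f x - b) u = kernelSum κ' k f u - k * b := by
  simp only [kernelSum, iterate_kernelAct_sub_const hf, Finset.sum_sub_distrib, Finset.sum_const,
    Finset.card_range, nsmul_eq_mul]

end Comparison

/-! ### A countable substitute for the bounded Lipschitz distance -/

section PartitionDist

/-- The sum over a countable partition `C` of the differences `|μ (C i) - ν (C i)|`. -/
noncomputable def partitionDist {E : Type*} [MeasurableSpace E] (C : ℕ → Set E)
    (μ ν : Measure E) : ℝ≥0∞ :=
  ∑' i, ENNReal.ofReal |μ.real (C i) - ν.real (C i)|

theorem hasSum_measureReal_partition {E : Type*} [MeasurableSpace E] {C : ℕ → Set E}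
    (hCm : ∀ i, MeasurableSet (C i)) (hCd : Pairwise (Function.onFun Disjoint C))
    (hCu : ⋃ i, C i = Set.univ) (μ : Measure E) [IsProbabilityMeasure μ] :
    HasSum (fun i => μ.real (C i)) 1 := by
  have h := hasSum_integral_iUnion hCm hCd (integrable_const (1 : ℝ) (μ := μ)).integrableOn
  rw [hCu] at h
  simpa using h

variable {E : Type*} [NormedAddCommGroup E] [MeasurableSpace E]

theorem blDist_nonneg (μ ν : Measure E) : 0 ≤ blDist μ ν := Real.iSup_nonneg fun _ => abs_nonneg _

/-- On a cell, a 1-Lipschitz function stays within `ε` of its value at the centre `d`. Replacing it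
by this constant costs `ε` times the mass of the cell, once for each measure, which sums to `2ε`;
the constants are at most `1` in absolute value. -/
theorem ofReal_blDist_le {C : ℕ → Set E} (hCm : ∀ i, MeasurableSet (C i))
    (hCd : Pairwise (Function.onFun Disjoint C)) (hCu : ⋃ i, C i = Set.univ) {ε : ℝ}
    (hCε : ∀ i, ∃ d, ∀ x ∈ C i, ‖x - d‖ ≤ ε) (μ ν : Measure E) [IsProbabilityMeasure μ]
    [IsProbabilityMeasure ν] :
    ENNReal.ofReal (blDist μ ν) ≤ ENNReal.ofReal (2 * ε) + partitionDist C μ ν := by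
  have hμ := hasSum_measureReal_partition hCm hCd hCu μ
  have hν := hasSum_measureReal_partition hCm hCd hCu ν
  have hs : Summable fun i => |μ.real (C i) - ν.real (C i)| := (hμ.summable.sub hν.summable).abs
  have hε : 0 ≤ ε := by
    have := nonempty_of_isProbabilityMeasure μ
    obtain ⟨i, hi⟩ := Set.mem_iUnion.1 (hCu.symm ▸ Set.mem_univ this.some)
    obtain ⟨d, hd⟩ := hCε i
    exact (norm_nonneg _).trans (hd _ hi)
  rw [partitionDist, ← ENNReal.ofReal_tsum_of_nonneg (fun _ => abs_nonneg _) hs,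
    ← ENNReal.ofReal_add (by positivity) (tsum_nonneg fun _ => abs_nonneg _)]
  refine ENNReal.ofReal_le_ofReal ?_
  have : Nonempty {f : E → ℝ // Measurable f ∧ (∀ x, |f x| ≤ 1) ∧
      ∀ x y, |f x - f y| ≤ ‖x - y‖} := ⟨0, measurable_const, by simp, by simp⟩
  refine ciSup_le fun ⟨f, hfm, hf1, hfL⟩ => ?_
  have hfb : BddMeasurable 1 f := ⟨hfm, hf1⟩
  have key : ∀ (ρ : Measure E) [IsProbabilityMeasure ρ], ∀ i d, (∀ x ∈ C i, ‖x - d‖ ≤ ε) →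
      |∫ x in C i, f x ∂ρ - f d * ρ.real (C i)| ≤ ε * ρ.real (C i) := by
    intro ρ _ i d hd
    have e : ∫ x in C i, f x ∂ρ - f d * ρ.real (C i) = ∫ x in C i, (f x - f d) ∂ρ := by
      rw [integral_sub (hfb.integrable _) (integrable_const _), setIntegral_const, smul_eq_mul,
        mul_comm]
    rw [e]
    exact norm_setIntegral_le_of_norm_le_const (f := fun x => f x - f d) (measure_lt_top _ _)
      fun x hx => (hfL x d).trans (hd x hx)
  have hterm : ∀ i, |∫ x in C i, f x ∂μ - ∫ x in C i, f x ∂ν| ≤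
      |μ.real (C i) - ν.real (C i)| + ε * (μ.real (C i) + ν.real (C i)) := by
    intro i
    obtain ⟨d, hd⟩ := hCε i
    have k1 := abs_le.1 (key μ i d hd)
    have k2 := abs_le.1 (key ν i d hd)
    have k3 : |f d * μ.real (C i) - f d * ν.real (C i)| ≤ |μ.real (C i) - ν.real (C i)| := by
      rw [← mul_sub, abs_mul]
      exact mul_le_of_le_one_left (abs_nonneg _) (hf1 d)
    have k3 := abs_le.1 k3
    rw [abs_le]
    constructor <;> nlinarith
  have iμ := hasSum_integral_iUnion hCm hCd (hfb.integrable μ).integrableOn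
  have iν := hasSum_integral_iUnion hCm hCd (hfb.integrable ν).integrableOn
  rw [hCu, setIntegral_univ] at iμ iν
  have hsub := iμ.sub iν
  have hr : HasSum (fun i => |μ.real (C i) - ν.real (C i)| + ε * (μ.real (C i) + ν.real (C i)))
      ((∑' i, |μ.real (C i) - ν.real (C i)|) + ε * (1 + 1)) :=
    hs.hasSum.add ((hμ.add hν).mul_left ε)
  have h1 : |∫ x, f x ∂μ - ∫ x, f x ∂ν| ≤ (∑' i, |μ.real (C i) - ν.real (C i)|) + ε * (1 + 1) := by
    rw [abs_le]
    constructor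
    · exact hasSum_le (fun i => (abs_le.1 (hterm i)).1) hr.neg hsub
    · exact hasSum_le (fun i => (le_abs_self _).trans (hterm i)) hsub hr
  simp only
  linarith

theorem exists_partition [BorelSpace E] [TopologicalSpace.SeparableSpace E] {ε : ℝ} (hε : 0 < ε) :
    ∃ C : ℕ → Set E, (∀ i, MeasurableSet (C i)) ∧ Pairwise (Function.onFun Disjoint C) ∧
      ⋃ i, C i = Set.univ ∧ ∀ i, ∃ d, ∀ x ∈ C i, ‖x - d‖ ≤ ε := by
  refine ⟨disjointed fun i => Metric.ball (TopologicalSpace.denseSeq E i) ε,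
    MeasurableSet.disjointed fun _ => measurableSet_ball, disjoint_disjointed _, ?_, fun i =>
    ⟨TopologicalSpace.denseSeq E i, fun x hx => ?_⟩⟩
  · rw [iUnion_disjointed, Set.eq_univ_iff_forall]
    intro x
    obtain ⟨y, hy, i, rfl⟩ := Metric.dense_iff.1 (TopologicalSpace.denseRange_denseSeq E) x ε hε
    exact Set.mem_iUnion.2 ⟨i, by rw [Metric.mem_ball, dist_comm]; exact hy⟩
  · have := disjointed_subset _ i hx
    rw [Metric.mem_ball, dist_eq_norm] at this
    exact this.le

end PartitionDist

/-! ### Empirical distributions of chains close to a limit kernel -/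

section Empirical

theorem measureReal_map_empiricalDist {T E : Type*} [MeasurableSpace T] [MeasurableSpace E]
    {l : T → E} (hl : Measurable l) (m : ℕ) (θ : ℕ → T) {B : Set E} (hB : MeasurableSet B) :
    ((empiricalDist m θ).map l).real B =
      (m : ℝ)⁻¹ * ∑ i ∈ Finset.range m, B.indicator (fun _ => (1 : ℝ)) (l (θ i)) := by
  rw [measureReal_def, Measure.map_apply hl hB, empiricalDist, Measure.smul_apply,
    Measure.finsetSum_apply, smul_eq_mul, ENNReal.toReal_mul, ENNReal.toReal_inv,
    ENNReal.toReal_natCast, ENNReal.toReal_sum]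
  · congr 1
    refine Finset.sum_congr rfl fun i _ => ?_
    rw [Measure.dirac_apply' _ (hl hB)]
    by_cases h : l (θ i) ∈ B <;> simp [h]
  · intro i _
    exact measure_ne_top _ _

theorem isProbabilityMeasure_empiricalDist {T : Type*} [MeasurableSpace T] {m : ℕ} (hm : 0 < m)
    (θ : ℕ → T) : IsProbabilityMeasure (empiricalDist m θ) := by
  constructor
  rw [empiricalDist, Measure.smul_apply, Measure.finsetSum_apply]
  simp only [measure_univ, Finset.sum_const, Finset.card_range, nsmul_eq_mul, mul_one, smul_eq_mul]
  exact ENNReal.inv_mul_cancel (by exact_mod_cast hm.ne') (ENNReal.natCast_ne_top m)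

variable {𝒳 T S : Type*} [MeasurableSpace 𝒳] [MeasurableSpace T] [MeasurableSpace S] {p : ℕ}

/-- The proposal step, with and without acceptance, of the algorithm `M` given the data `x` is
within `a` in total variation of that of the limit model at `σ`, in the coordinate `l`. -/
def MetropolisHastings.IsClose (M : MetropolisHastings 𝒳 T) (x : 𝒳) (L : LimitModel S p) (σ : S)
    (l : T → EuclideanSpace ℝ (Fin p)) (a : ℝ) : Prop :=
  (∀ F : EuclideanSpace ℝ (Fin p) × EuclideanSpace ℝ (Fin p) → ℝ, BddMeasurable 1 F →
    |∫ z, F (Prod.map l l z) ∂(M.target x ⊗ₘ M.proposal.sectR x) -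
      ∫ z, F z ∂(L.target σ ⊗ₘ L.proposal.sectR σ)| ≤ a) ∧
  ∀ F : EuclideanSpace ℝ (Fin p) × EuclideanSpace ℝ (Fin p) → ℝ, BddMeasurable 1 F →
    |∫ z, M.accept x z.1 z.2 * F (Prod.map l l z) ∂(M.target x ⊗ₘ M.proposal.sectR x) -
      ∫ z, L.accept σ z.1 z.2 * F z ∂(L.target σ ⊗ₘ L.proposal.sectR σ)| ≤ a

instance (L : LimitModel S p) : IsMarkovKernel L.kernel :=
  isMarkovKernel_metropolisKernel L.proposal L.accept L.measurable_accept

variable {M : MetropolisHastings 𝒳 T} {x : 𝒳} {L : LimitModel S p} {σ : S}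
  {l : T → EuclideanSpace ℝ (Fin p)} {a : ℝ}

namespace MetropolisHastings.IsClose

theorem abs_integral_sub_le (h : M.IsClose x L σ l a) (hl : Measurable l)
    {f : EuclideanSpace ℝ (Fin p) → ℝ} (hf : BddMeasurable 1 f) :
    |∫ u, f (l u) ∂(M.target x) - ∫ y, f y ∂(L.target σ)| ≤ a := by
  have h1 := h.1 _ (hf.comp (measurable_fst (β := EuclideanSpace ℝ (Fin p))))
  rw [Measure.integral_compProd ((hf.comp measurable_fst).integrable _)] at h1
  have hint : Integrable (fun z : T × T => f (l z.1)) (M.target x ⊗ₘ M.proposal.sectR x) :=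
    ((hf.comp hl).comp measurable_fst).integrable _
  have e := Measure.integral_compProd hint
  simp only [Function.comp_apply, Prod.map_fst] at h1 e
  rw [e] at h1
  simpa using h1

theorem integral_abs_kernelAct_sub_le (h : M.IsClose x L σ l a) (hl : MeasurableEmbedding l)
    {f : EuclideanSpace ℝ (Fin p) → ℝ} (hf : BddMeasurable 1 f) :
    ∫ u, |kernelAct (M.kernel.sectR x) (f ∘ l) u - kernelAct (L.kernel.sectR σ) f (l u)|
      ∂(M.target x) ≤ 4 * a := by
  have hA' : Measurable fun z : T × T => M.accept x z.1 z.2 :=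
    M.measurable_accept.comp (by fun_prop : Measurable fun z : T × T => ((x, z.1), z.2))
  have hA : Measurable fun z : EuclideanSpace ℝ (Fin p) × EuclideanSpace ℝ (Fin p) =>
      L.accept σ z.1 z.2 := L.measurable_accept.comp (by fun_prop : Measurable fun
        z : EuclideanSpace ℝ (Fin p) × EuclideanSpace ℝ (Fin p) => ((σ, z.1), z.2))
  exact _root_.integral_abs_kernelAct_sub_le (κ' := M.kernel.sectR x) (κ := L.kernel.sectR σ) (BddMeasurable.accept hA') (BddMeasurable.accept hA) hl
    (fun g hg u => kernelAct_metropolisKernel M.proposal M.measurable_accept hg x u)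
    (fun g hg u => kernelAct_metropolisKernel L.proposal L.measurable_accept hg σ u) h.1 h.2 hf

end MetropolisHastings.IsClose

theorem BddMeasurable.indicator_sub {E : Type*} [MeasurableSpace E] {B : Set E}
    (hB : MeasurableSet B) {b : ℝ} (h0 : 0 ≤ b) (h1 : b ≤ 1) :
    BddMeasurable 1 (fun y => B.indicator (fun _ => (1 : ℝ)) y - b) := by
  refine ⟨(measurable_const.indicator hB).sub_const b, fun y => ?_⟩
  simp only
  by_cases hy : y ∈ B
  · rw [Set.indicator_of_mem hy, abs_le]; constructor <;> linarith
  · rw [Set.indicator_of_notMem hy, abs_le]; constructor <;> linarith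

theorem BddMeasurable.indicator_one {E : Type*} [MeasurableSpace E] {B : Set E}
    (hB : MeasurableSet B) : BddMeasurable 1 (B.indicator fun _ => (1 : ℝ)) := by
  simpa using BddMeasurable.indicator_sub hB le_rfl zero_le_one

/-- The mean absolute error on one set. -/
theorem MetropolisHastings.IsClose.integral_abs_sub_le (h : M.IsClose x L σ l a)
    (hl : MeasurableEmbedding l) {B : Set (EuclideanSpace ℝ (Fin p))} (hB : MeasurableSet B)
    {k m : ℕ} (hk : 0 < k) (hm : 0 < m) :
    ∫ θ, |((M.target x).map l).real B - ((empiricalDist m θ).map l).real B| ∂(M.chain x) ≤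
      √(2 * ((∫ y, |kernelSum (L.kernel.sectR σ) k
        (fun y => B.indicator (fun _ => 1) y - (L.target σ).real B) y| ∂(L.target σ)) / k +
          2 * a + k * (4 * a) + k / m)) := by
  set b := (L.target σ).real B with hb
  set b' := ((M.target x).map l).real B with hb'
  have : IsProbabilityMeasure ((M.target x).map l) :=
    Measure.isProbabilityMeasure_map hl.measurable.aemeasurable
  have hb'eq : ∫ u, B.indicator (fun _ => (1 : ℝ)) (l u) ∂(M.target x) = b' := by
    rw [hb', ← integral_map (f := B.indicator fun _ => (1 : ℝ)) hl.measurable.aemeasurable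
      (BddMeasurable.indicator_one hB).1.aestronglyMeasurable, integral_indicator_const _ hB]
    simp
  have hbeq : ∫ y, B.indicator (fun _ => (1 : ℝ)) y ∂(L.target σ) = b := by
    rw [integral_indicator_const _ hB]; simp [hb]
  have hbb : |b' - b| ≤ a := by
    rw [← hb'eq, ← hbeq]; exact h.abs_integral_sub_le hl.measurable (BddMeasurable.indicator_one hB)
  have hg := BddMeasurable.indicator_sub hB (measureReal_nonneg (μ := L.target σ) (s := B))
    measureReal_le_one
  have hg' := (BddMeasurable.indicator_sub hB (measureReal_nonneg (μ := (M.target x).map l) (s := B))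
    measureReal_le_one).comp hl.measurable
  rw [← hb] at hg
  rw [← hb'] at hg'
  set g : EuclideanSpace ℝ (Fin p) → ℝ := fun y => B.indicator (fun _ => (1 : ℝ)) y - b with hgdef
  set g' : T → ℝ := (fun y => B.indicator (fun _ => (1 : ℝ)) y - b') ∘ l with hg'def
  set Z : (ℕ → T) → ℝ := fun θ => (m : ℝ)⁻¹ * ∑ i ∈ Finset.range m, g' (θ i) with hZ
  have hm' : (0 : ℝ) < m := by exact_mod_cast hm
  have hk' : (0 : ℝ) < k := by exact_mod_cast hk
  have hZeq : ∀ θ, |b' - ((empiricalDist m θ).map l).real B| = |Z θ| := by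
    intro θ
    rw [abs_sub_comm, measureReal_map_empiricalDist hl.measurable m θ hB]
    congr 1
    simp only [hZ, hg'def, Function.comp_apply, Finset.sum_sub_distrib, Finset.sum_const,
      Finset.card_range, nsmul_eq_mul]
    field_simp
  have hZb : BddMeasurable (m : ℝ)⁻¹ (fun _ : ℕ → T => (m : ℝ)⁻¹) :=
    ⟨measurable_const, fun _ => by rw [abs_of_nonneg (by positivity)]⟩
  have hZb := hZb.mul (BddMeasurable.sum (Finset.range m)
    fun i _ => hg'.comp (measurable_pi_apply (X := fun _ : ℕ => T) i))
  have hsq := integral_sq_average_le (M.invariant_kernel x)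
    (fun i => measurable_pi_apply (X := fun _ : ℕ => T) i) hg'
    (fun i j => M.integral_mul_chain x hg' hg' i j) hk hm
  have hcomp := integral_abs_kernelSum_comp_le (M.invariant_kernel x) hl.measurable
    (fun f hf => h.integral_abs_kernelAct_sub_le hl hf)
    (fun f hf => h.abs_integral_sub_le hl.measurable hf) hg hk
  -- The average is centred at the posterior mass `b'` of `B`, whereas the limit kernel calls for
  -- centring at `b`. Constants pass through the kernel, so the shift costs `|b' - b| ≤ a`, the
  -- second of the two terms `a`.
  have hshift : (∫ u, |kernelSum (M.kernel.sectR x) k g' u| ∂(M.target x)) / k ≤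
      (∫ u, |kernelSum (M.kernel.sectR x) k (g ∘ l) u| ∂(M.target x)) / k + a := by
    have e : g' = fun u => (g ∘ l) u - (b' - b) := by
      funext u; simp only [hg'def, hgdef, Function.comp_apply]; ring
    have hgl := hg.comp hl.measurable
    have hs := hgl.kernelSum (κ := M.kernel.sectR x) k
    rw [div_add' _ _ _ hk'.ne', div_le_div_iff_of_pos_right hk']
    calc ∫ u, |kernelSum (M.kernel.sectR x) k g' u| ∂(M.target x)
        ≤ ∫ u, (|kernelSum (M.kernel.sectR x) k (g ∘ l) u| + a * k) ∂(M.target x) := by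
          refine integral_mono ((hg'.kernelSum (κ := M.kernel.sectR x) k).abs.integrable _)
            ((hs.abs.integrable _).add (integrable_const _)) fun u => ?_
          simp only
          rw [e, kernelSum_sub_const hgl]
          refine (abs_sub _ _).trans (add_le_add le_rfl ?_)
          rw [abs_mul, abs_of_pos hk', mul_comm]
          gcongr
      _ = _ := by
          rw [integral_add (hs.abs.integrable _) (integrable_const _)]
          simp
  have hvar : (∫ θ, |Z θ| ∂(M.chain x)) ^ 2 ≤ ∫ θ, Z θ ^ 2 ∂(M.chain x) := by
    have h1 := variance_nonneg (fun θ => |Z θ|) (M.chain x)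
    have hmem : MemLp (fun θ => |Z θ|) 2 (M.chain x) := BddMeasurable.memLp hZb.abs
    rw [variance_eq_sub hmem] at h1
    simp only [Pi.pow_apply, sq_abs] at h1
    linarith
  simp_rw [hZeq]
  refine (le_abs_self _).trans (Real.abs_le_sqrt (hvar.trans (hsq.trans ?_)))
  gcongr
  linarith

/-- The mean absolute error on one set is at most twice its mass. -/
theorem MetropolisHastings.lintegral_abs_sub_le (M : MetropolisHastings 𝒳 T) (x : 𝒳)
    (hl : Measurable l) {B : Set (EuclideanSpace ℝ (Fin p))} (hB : MeasurableSet B)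
    {m : ℕ} (hm : 0 < m) :
    ∫⁻ θ, ENNReal.ofReal |((M.target x).map l).real B - ((empiricalDist m θ).map l).real B|
      ∂(M.chain x) ≤ 2 * (M.target x).map l B := by
  have : IsProbabilityMeasure ((M.target x).map l) :=
    Measure.isProbabilityMeasure_map hl.aemeasurable
  set b' := ((M.target x).map l).real B with hb'
  have hi := (BddMeasurable.indicator_one hB).comp hl
  have hm' : (0 : ℝ) < m := by exact_mod_cast hm
  have hb'eq : ∫ u, B.indicator (fun _ => (1 : ℝ)) (l u) ∂(M.target x) = b' := by
    rw [hb', ← integral_map (f := B.indicator fun _ => (1 : ℝ)) hl.aemeasurable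
      (BddMeasurable.indicator_one hB).1.aestronglyMeasurable, integral_indicator_const _ hB]
    simp
  have hone : ∀ i, ∫ θ, B.indicator (fun _ => (1 : ℝ)) (l (θ i)) ∂(M.chain x) = b' := by
    intro i
    have := M.integral_mul_chain x hi (g := fun _ => 1) (c' := 1) ⟨measurable_const, by simp⟩ i 0
    simpa [hb'eq] using this
  have hii : ∀ i, Integrable (fun θ : ℕ → T => B.indicator (fun _ => (1 : ℝ)) (l (θ i)))
      (M.chain x) := fun i => (hi.comp (measurable_pi_apply (X := fun _ : ℕ => T) i)).integrable _
  -- By stationarity the empirical mass of `B` has mean `b'`.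
  have hν : ∫ θ, ((empiricalDist m θ).map l).real B ∂(M.chain x) = b' := by
    simp_rw [measureReal_map_empiricalDist hl m _ hB]
    rw [integral_const_mul, integral_finsetSum _ fun i _ => hii i]
    simp_rw [hone]
    rw [Finset.sum_const, Finset.card_range, nsmul_eq_mul]
    field_simp
  have hνi : Integrable (fun θ => ((empiricalDist m θ).map l).real B) (M.chain x) := by
    simp_rw [measureReal_map_empiricalDist hl m _ hB]
    exact (integrable_finsetSum _ fun i _ => hii i).const_mul _
  calc _ ≤ ∫⁻ θ, ENNReal.ofReal (b' + ((empiricalDist m θ).map l).real B) ∂(M.chain x) := by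
        refine lintegral_mono fun θ => ENNReal.ofReal_le_ofReal ?_
        refine (abs_sub _ _).trans ?_
        rw [abs_of_nonneg measureReal_nonneg, abs_of_nonneg measureReal_nonneg]
    _ = ENNReal.ofReal (2 * b') := by
        have hadd : Integrable (fun θ => b' + ((empiricalDist m θ).map l).real B) (M.chain x) :=
          (integrable_const _).add hνi
        rw [← ofReal_integral_eq_lintegral_ofReal hadd
          (ae_of_all _ fun θ => add_nonneg measureReal_nonneg measureReal_nonneg),
          integral_add (integrable_const _) hνi, hν]
        simp [two_mul]
    _ = _ := by
        rw [ENNReal.ofReal_mul zero_le_two, hb', ofReal_measureReal]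
        simp

/-- The mean error over a countable partition. -/
theorem MetropolisHastings.IsClose.lintegral_partitionDist_le (h : M.IsClose x L σ l a)
    (hl : MeasurableEmbedding l) {C : ℕ → Set (EuclideanSpace ℝ (Fin p))}
    (hCm : ∀ i, MeasurableSet (C i)) (hCd : Pairwise (Function.onFun Disjoint C))
    {k m : ℕ} (hk : 0 < k) (hm : 0 < m) (n : ℕ) :
    ∫⁻ θ, partitionDist C ((M.target x).map l) ((empiricalDist m θ).map l) ∂(M.chain x) ≤
      ∑ i ∈ Finset.range n, ENNReal.ofReal (√(2 * ((∫ y, |kernelSum (L.kernel.sectR σ) k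
        (fun y => (C i).indicator (fun _ => 1) y - (L.target σ).real (C i)) y| ∂(L.target σ)) / k +
          2 * a + k * (4 * a) + k / m))) +
      2 * (L.target σ (⋃ i, C (i + n)) + ENNReal.ofReal a) := by
  have hmeas : ∀ i, Measurable fun θ : ℕ → T => ((M.target x).map l).real (C i) -
      ((empiricalDist m θ).map l).real (C i) := by
    intro i
    simp_rw [measureReal_map_empiricalDist hl.measurable m _ (hCm i)]
    refine measurable_const.sub (measurable_const.mul (Finset.measurable_fun_sum _ fun j _ => ?_))
    exact ((measurable_const.indicator (hCm i)).comp hl.measurable).comp (measurable_pi_apply j)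
  have : IsProbabilityMeasure ((M.target x).map l) :=
    Measure.isProbabilityMeasure_map hl.measurable.aemeasurable
  simp only [partitionDist]
  rw [lintegral_tsum fun i => (hmeas i).abs.ennreal_ofReal.aemeasurable,
    ← ENNReal.summable.sum_add_tsum_nat_add' (k := n)]
  refine add_le_add (Finset.sum_le_sum fun i _ => ?_) ?_
  · have hint : Integrable (fun θ : ℕ → T => |((M.target x).map l).real (C i) -
        ((empiricalDist m θ).map l).real (C i)|) (M.chain x) := by
      refine Integrable.of_bound (hmeas i).abs.aestronglyMeasurable 1 (ae_of_all _ fun θ => ?_)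
      have := isProbabilityMeasure_empiricalDist hm θ
      have : IsProbabilityMeasure ((empiricalDist m θ).map l) :=
        Measure.isProbabilityMeasure_map hl.measurable.aemeasurable
      rw [Real.norm_eq_abs, abs_abs]
      exact abs_sub_le_of_nonneg_of_le measureReal_nonneg measureReal_le_one measureReal_nonneg
        measureReal_le_one
    rw [← ofReal_integral_eq_lintegral_ofReal hint (ae_of_all _ fun _ => abs_nonneg _)]
    exact ENNReal.ofReal_le_ofReal (h.integral_abs_sub_le hl (hCm i) hk hm)
  -- In the tail no ergodicity is used: the errors sum to at most twice the posterior mass of the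
  -- remaining cells, which closeness compares with the limit mass.
  · calc _ ≤ ∑' i, 2 * (M.target x).map l (C (i + n)) :=
          ENNReal.tsum_le_tsum fun i => M.lintegral_abs_sub_le x hl.measurable (hCm _) hm
      _ = 2 * (M.target x).map l (⋃ i, C (i + n)) := by
          have hd : Pairwise (Function.onFun Disjoint fun i => C (i + n)) :=
            fun i j hij => hCd fun hn => hij (Nat.add_right_cancel hn)
          rw [ENNReal.tsum_mul_left, measure_iUnion hd fun i => hCm _]
      _ ≤ _ := by
          gcongr
          have hU : MeasurableSet (⋃ i, C (i + n)) := MeasurableSet.iUnion fun i => hCm _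
          have h1 := (abs_le.1 (h.abs_integral_sub_le hl.measurable
            (BddMeasurable.indicator_one hU))).2
          rw [← integral_map (f := (⋃ i, C (i + n)).indicator fun _ => (1 : ℝ))
            hl.measurable.aemeasurable
            (BddMeasurable.indicator_one hU).1.aestronglyMeasurable,
            integral_indicator_const _ hU, integral_indicator_const _ hU] at h1
          simp only [smul_eq_mul, mul_one] at h1
          have ha : 0 ≤ a := (abs_nonneg _).trans (h.abs_integral_sub_le hl.measurable
            (BddMeasurable.indicator_one hU))
          rw [← ofReal_measureReal, ← ofReal_measureReal (μ := L.target σ),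
            ← ENNReal.ofReal_add measureReal_nonneg ha]
          exact ENNReal.ofReal_le_ofReal (by linarith)

end Empirical

section Uniform

universe u

variable {T S : Type*} [MeasurableSpace T] [MeasurableSpace S] {p : ℕ}

/-- Chains close to an ergodic limit kernel have small mean error, uniformly in the data. -/
theorem exists_forall_lintegral_partitionDist_le (L : LimitModel S p) (σ : S)
    (hσ : IsErgodicKernel (L.kernel.sectR σ) (L.target σ))
    {C : ℕ → Set (EuclideanSpace ℝ (Fin p))} (hCm : ∀ i, MeasurableSet (C i))
    (hCd : Pairwise (Function.onFun Disjoint C)) {η : ℝ} (hη : 0 < η) :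
    ∃ a : ℝ, 0 < a ∧ ∃ m₀ : ℕ, ∀ (𝒳 : Type u) [MeasurableSpace 𝒳] (M : MetropolisHastings 𝒳 T)
      (x : 𝒳) (l : T → EuclideanSpace ℝ (Fin p)), MeasurableEmbedding l → M.IsClose x L σ l a →
      ∀ m ≥ m₀, ∫⁻ θ, partitionDist C ((M.target x).map l) ((empiricalDist m θ).map l)
        ∂(M.chain x) ≤ ENNReal.ofReal η := by
  -- the tail of the partition
  have htail : Tendsto (fun n => L.target σ (⋃ i, C (i + n))) atTop (𝓝 0) := by
    have hd : ∀ n, Pairwise (Function.onFun Disjoint fun i => C (i + n)) :=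
      fun n i j hij => hCd fun hn => hij (Nat.add_right_cancel hn)
    have h1 : (fun n => L.target σ (⋃ i, C (i + n))) = fun n => ∑' i, L.target σ (C (i + n)) :=
      funext fun n => measure_iUnion (hd n) fun i => hCm _
    rw [h1]
    refine ENNReal.tendsto_sum_nat_add (fun i => L.target σ (C i)) ?_
    rw [← measure_iUnion hCd hCm]
    exact measure_ne_top _ _
  obtain ⟨n, hn⟩ := (htail.eventually_le_const (ENNReal.ofReal_pos.2 (by positivity : 0 < η / 8))).exists
  -- The error allowed for each of the `n` head cells, so that `n t ≤ η / 2`; the `+ 1` covers `n =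
  -- 0`.
  set t : ℝ := η / (2 * (n + 1)) with ht
  have ht0 : 0 < t := by positivity
  -- the averaging time
  obtain ⟨φ, -, hφ0, hφ⟩ := hσ.irreducible
  have havg : ∀ i, Tendsto (fun k : ℕ => (∫ y, |kernelSum (L.kernel.sectR σ) k
      (fun y => (C i).indicator (fun _ => 1) y - (L.target σ).real (C i)) y| ∂(L.target σ)) / k)
      atTop (𝓝 0) := by
    intro i
    have hb := BddMeasurable.indicator_one (hCm i)
    refine tendsto_integral_abs_kernelSum hσ.invariant hφ0 hφ
      (BddMeasurable.indicator_sub (hCm i) measureReal_nonneg measureReal_le_one) ?_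
    rw [integral_sub (hb.integrable _) (integrable_const _), integral_indicator_const _ (hCm i)]
    simp
  have hev : ∀ᶠ k : ℕ in atTop, ∀ i ∈ Finset.range n, (∫ y, |kernelSum (L.kernel.sectR σ) k
      (fun y => (C i).indicator (fun _ => 1) y - (L.target σ).real (C i)) y| ∂(L.target σ)) / k ≤
      t ^ 2 / 8 :=
    (Finset.eventually_all _).2 fun i _ => (havg i).eventually_le_const (by positivity)
  obtain ⟨k, hk, hk0⟩ := (hev.and (eventually_gt_atTop 0)).exists
  have hk' : (0 : ℝ) < k := by exact_mod_cast hk0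
  obtain ⟨m₀, hm₀⟩ := exists_nat_gt (k / (t ^ 2 / 8))
  -- The first entry controls the tail, `2 (η/8 + η/8) = η/2`. The second gives `2a + 4ka ≤ t²/8`,
  -- so the root is at most `√(2 · 3t²/8) ≤ t`. The threshold `m₀ + 1` also excludes `m = 0`.
  refine ⟨min (η / 8) (t ^ 2 / 8 / (2 + 4 * k)), by positivity, m₀ + 1, ?_⟩
  intro 𝒳 _ M x l hl hclose m hm
  set a := min (η / 8) (t ^ 2 / 8 / (2 + 4 * k)) with ha
  have hm0 : 0 < m := by omega
  have hm' : (0 : ℝ) < m := by exact_mod_cast hm0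
  have ha1 : a ≤ η / 8 := min_le_left _ _
  have ha2 : 2 * a + k * (4 * a) ≤ t ^ 2 / 8 := by
    have : a ≤ t ^ 2 / 8 / (2 + 4 * k) := min_le_right _ _
    rw [le_div_iff₀ (by positivity)] at this
    linarith
  have hkm : (k : ℝ) / m ≤ t ^ 2 / 8 := by
    rw [div_lt_iff₀ (by positivity)] at hm₀
    rw [div_le_iff₀ hm']
    have : (m₀ : ℝ) ≤ m := by exact_mod_cast (by omega : m₀ ≤ m)
    nlinarith [sq_nonneg t]
  refine (hclose.lintegral_partitionDist_le hl hCm hCd hk0 hm0 n).trans ?_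
  calc _ ≤ ∑ i ∈ Finset.range n, ENNReal.ofReal t +
        2 * (ENNReal.ofReal (η / 8) + ENNReal.ofReal (η / 8)) := by
        refine add_le_add (Finset.sum_le_sum fun i hi => ENNReal.ofReal_le_ofReal ?_) ?_
        · have := hk i hi
          refine Real.sqrt_le_iff.2 ⟨ht0.le, ?_⟩
          linarith [sq_nonneg t]
        · gcongr
    _ = ENNReal.ofReal (n * t + 2 * (η / 8 + η / 8)) := by
        rw [Finset.sum_const, Finset.card_range, nsmul_eq_mul, ENNReal.ofReal_add (by positivity)
          (by positivity), ENNReal.ofReal_mul (by positivity), ENNReal.ofReal_mul zero_le_two,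
          ENNReal.ofReal_add (by positivity) (by positivity)]
        simp
    _ ≤ ENNReal.ofReal η := by
        refine ENNReal.ofReal_le_ofReal ?_
        have : n * t ≤ η / 2 := by
          rw [ht, mul_div_assoc', div_le_div_iff₀ (by positivity) two_pos]
          nlinarith
        linarith

end Uniform

/-! ### Scheffé's lemma and continuity of the limit model -/

/-- Scheffé's lemma. -/
theorem tendsto_integral_abs_sub_of_tendsto {ι Y : Type*} [MeasurableSpace Y] {μ : Measure Y}
    {F : Filter ι} [F.IsCountablyGenerated] {f : ι → Y → ℝ} {g : Y → ℝ}
    (hf0 : ∀ i y, 0 ≤ f i y) (hg0 : ∀ y, 0 ≤ g y) (hf : ∀ i, Integrable (f i) μ)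
    (hg : Integrable g μ) (heq : ∀ i, ∫ y, f i y ∂μ = ∫ y, g y ∂μ)
    (hlim : ∀ y, Tendsto (fun i => f i y) F (𝓝 (g y))) :
    Tendsto (fun i => ∫ y, |f i y - g y| ∂μ) F (𝓝 0) := by
  have hpos : ∀ i, Integrable (fun y => max (g y - f i y) 0) μ := fun i => (hg.sub (hf i)).pos_part
  -- Since `f i` and `g` have equal integrals, only the positive part of `g - f i` matters, and it
  -- is dominated by `g`.
  have h1 : ∀ i, ∫ y, |f i y - g y| ∂μ = 2 * ∫ y, max (g y - f i y) 0 ∂μ := by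
    intro i
    have e : ∀ y, |f i y - g y| = (f i y - g y) + 2 * max (g y - f i y) 0 := by
      intro y
      rcases le_total (g y) (f i y) with h | h
      · rw [abs_of_nonneg (by linarith), max_eq_right (by linarith)]; ring
      · rw [abs_of_nonpos (by linarith), max_eq_left (by linarith)]; ring
    simp_rw [e]
    rw [integral_add (f := fun y => f i y - g y) ((hf i).sub hg) ((hpos i).const_mul 2),
      integral_sub (hf i) hg, heq i, integral_const_mul]
    ring
  simp_rw [h1]
  have h2 : Tendsto (fun i => ∫ y, max (g y - f i y) 0 ∂μ) F (𝓝 (∫ _, 0 ∂μ)) := by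
    refine tendsto_integral_filter_of_dominated_convergence g
      (Eventually.of_forall fun i => (hpos i).aestronglyMeasurable)
      (Eventually.of_forall fun i => ae_of_all _ fun y => ?_) hg (ae_of_all _ fun y => ?_)
    · rw [Real.norm_eq_abs, abs_of_nonneg (le_max_right _ _)]
      exact max_le (by linarith [hf0 i y]) (hg0 y)
    · have := (Tendsto.sub (tendsto_const_nhds (x := g y)) (hlim y)).max
        (tendsto_const_nhds (x := (0 : ℝ)))
      simpa using this
  simpa using h2.const_mul 2

namespace LimitModel

variable {S : Type*} [MeasurableSpace S] {p : ℕ} (L : LimitModel S p)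

/-- The law of the current state and the proposal in the limit model. -/
noncomputable def pairLaw (σ : S) : Measure (EuclideanSpace ℝ (Fin p) × EuclideanSpace ℝ (Fin p)) :=
  L.target σ ⊗ₘ L.proposal.sectR σ

instance (σ : S) : IsProbabilityMeasure (L.pairLaw σ) := by unfold pairLaw; infer_instance

/-- The joint density of the current state and the proposal in the limit model. -/
noncomputable def pairDensity (σ : S) (z : EuclideanSpace ℝ (Fin p) × EuclideanSpace ℝ (Fin p)) :
    ℝ≥0 := L.targetDensity σ z.1 * L.proposalDensity σ z.1 z.2

theorem measurable_pairDensity (σ : S) : Measurable (L.pairDensity σ) :=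
  (L.measurable_targetDensity.comp (by fun_prop : Measurable fun
    z : EuclideanSpace ℝ (Fin p) × EuclideanSpace ℝ (Fin p) => (σ, z.1))).mul
  (L.measurable_proposalDensity.comp (by fun_prop : Measurable fun
    z : EuclideanSpace ℝ (Fin p) × EuclideanSpace ℝ (Fin p) => ((σ, z.1), z.2)))

theorem target_apply (σ : S) :
    L.target σ = volume.withDensity fun u => (L.targetDensity σ u : ℝ≥0∞) := by
  rw [target, Kernel.withDensity_apply _
    (by exact measurable_coe_nnreal_ennreal.comp L.measurable_targetDensity), Kernel.const_apply]

theorem proposal_apply (σ : S) (u : EuclideanSpace ℝ (Fin p)) :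
    L.proposal (σ, u) = volume.withDensity fun v => (L.proposalDensity σ u v : ℝ≥0∞) := by
  rw [proposal, Kernel.withDensity_apply _
    (by exact measurable_coe_nnreal_ennreal.comp L.measurable_proposalDensity), Kernel.const_apply]

/-- Tonelli. All pair laws thus have densities with respect to one measure independent of `σ`, so
they can be compared through the `L¹` distance of their densities. -/
theorem pairLaw_eq_withDensity (σ : S) :
    L.pairLaw σ = (volume.prod volume).withDensity fun z => (L.pairDensity σ z : ℝ≥0∞) := by
  ext B hB
  have hπ : Measurable fun u => (L.targetDensity σ u : ℝ≥0∞) :=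
    measurable_coe_nnreal_ennreal.comp (L.measurable_targetDensity.comp measurable_prodMk_left)
  have hq : ∀ u, Measurable fun v => (L.proposalDensity σ u v : ℝ≥0∞) := fun u =>
    measurable_coe_nnreal_ennreal.comp (L.measurable_proposalDensity.comp
      (measurable_prodMk_left (x := (σ, u))))
  have hρ := measurable_coe_nnreal_ennreal.comp (L.measurable_pairDensity σ)
  have hm : Measurable fun u => L.proposal.sectR σ u (Prod.mk u ⁻¹' B) :=
    Kernel.measurable_kernel_prodMk_left hB
  rw [pairLaw, Measure.compProd_apply hB, target_apply, lintegral_withDensity_eq_lintegral_mul _ hπ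
    hm, withDensity_apply _ hB, ← lintegral_indicator hB]
  refine Eq.trans ?_ (lintegral_prod _ (hρ.indicator hB).aemeasurable).symm
  refine lintegral_congr fun u => ?_
  have hBu : MeasurableSet (Prod.mk u ⁻¹' B) := measurable_prodMk_left hB
  rw [Pi.mul_apply, Kernel.sectR_apply, proposal_apply, withDensity_apply _ hBu,
    ← lintegral_indicator hBu, ← lintegral_const_mul _ ((hq u).indicator hBu)]
  refine lintegral_congr fun v => ?_
  by_cases h : (u, v) ∈ B
  · have h' : v ∈ Prod.mk u ⁻¹' B := h
    simp [h, h', pairDensity]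
  · have h' : v ∉ Prod.mk u ⁻¹' B := h
    simp [h, h']

theorem integral_pairLaw (σ : S)
    (F : EuclideanSpace ℝ (Fin p) × EuclideanSpace ℝ (Fin p) → ℝ) :
    ∫ z, F z ∂(L.pairLaw σ) = ∫ z, (L.pairDensity σ z : ℝ) * F z ∂(volume.prod volume) := by
  rw [pairLaw_eq_withDensity, integral_withDensity_eq_integral_smul (L.measurable_pairDensity σ)]
  rfl

theorem integrable_pairDensity (σ : S) :
    Integrable (fun z => (L.pairDensity σ z : ℝ)) (volume.prod volume) := by
  have h : HasFiniteIntegral (fun z => (L.pairDensity σ z : ℝ)) (volume.prod volume) := by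
    rw [hasFiniteIntegral_iff_enorm]
    have : ∫⁻ z, ‖(L.pairDensity σ z : ℝ)‖ₑ ∂(volume.prod volume) = L.pairLaw σ Set.univ := by
      rw [pairLaw_eq_withDensity, withDensity_apply _ MeasurableSet.univ, setLIntegral_univ]
      simp
    rw [this]
    exact measure_lt_top _ _
  exact ⟨(measurable_subtype_coe.comp (L.measurable_pairDensity σ)).aestronglyMeasurable, h⟩

theorem integral_pairDensity (σ : S) :
    ∫ z, (L.pairDensity σ z : ℝ) ∂(volume.prod volume) = 1 := by
  have := L.integral_pairLaw σ fun _ => 1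
  simpa using this.symm

theorem abs_integral_pairLaw_sub_le (σ τ : S)
    {F : EuclideanSpace ℝ (Fin p) × EuclideanSpace ℝ (Fin p) → ℝ} (hF : BddMeasurable 1 F) :
    |∫ z, F z ∂(L.pairLaw σ) - ∫ z, F z ∂(L.pairLaw τ)| ≤
      ∫ z, |(L.pairDensity σ z : ℝ) - L.pairDensity τ z| ∂(volume.prod volume) := by
  have hi : ∀ σ, Integrable (fun z => (L.pairDensity σ z : ℝ) * F z) (volume.prod volume) :=
    fun σ => (L.integrable_pairDensity σ).mul_bdd hF.1.aestronglyMeasurable (ae_of_all _ hF.2)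
  rw [integral_pairLaw, integral_pairLaw, ← integral_sub (hi σ) (hi τ)]
  refine abs_integral_le_integral_abs.trans (integral_mono ((hi σ).sub (hi τ)).abs
    ((L.integrable_pairDensity σ).sub (L.integrable_pairDensity τ)).abs fun z => ?_)
  simp only
  rw [← sub_mul, abs_mul]
  exact mul_le_of_le_one_right (abs_nonneg _) (hF.2 z)

theorem measurable_accept_right (σ : S) :
    Measurable fun z : EuclideanSpace ℝ (Fin p) × EuclideanSpace ℝ (Fin p) =>
      L.accept σ z.1 z.2 :=
  L.measurable_accept.comp (by fun_prop : Measurable fun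
    z : EuclideanSpace ℝ (Fin p) × EuclideanSpace ℝ (Fin p) => ((σ, z.1), z.2))

variable [TopologicalSpace S]

/-- Scheffé's lemma: the densities are pointwise continuous in the parameter and all integrate to
`1`. First countability makes the neighbourhood filter countably generated, as dominated convergence
requires. -/
theorem tendsto_integral_abs_pairDensity_sub [FirstCountableTopology S] (hL : L.IsRegular)
    (σ : S) : Tendsto (fun τ => ∫ z, |(L.pairDensity τ z : ℝ) - L.pairDensity σ z|
      ∂(volume.prod volume)) (𝓝 σ) (𝓝 0) := by
  refine tendsto_integral_abs_sub_of_tendsto (fun _ _ => NNReal.coe_nonneg _)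
    (fun _ => NNReal.coe_nonneg _) (fun τ => L.integrable_pairDensity τ)
    (L.integrable_pairDensity σ) (fun τ => by rw [integral_pairDensity, integral_pairDensity])
    fun z => ?_
  have : Continuous fun τ => (L.pairDensity τ z : ℝ) :=
    NNReal.continuous_coe.comp ((hL.continuous_targetDensity z.1).mul
      (hL.continuous_proposalDensity z.1 z.2))
  exact this.tendsto σ

theorem tendsto_integral_abs_accept_sub [FirstCountableTopology S] (hL : L.IsRegular) (σ : S) :
    Tendsto (fun τ => ∫ z, |(L.accept τ z.1 z.2 : ℝ) - L.accept σ z.1 z.2| ∂(L.pairLaw σ))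
      (𝓝 σ) (𝓝 0) := by
  have hb : ∀ τ, BddMeasurable (1 + 1) fun z :
      EuclideanSpace ℝ (Fin p) × EuclideanSpace ℝ (Fin p) =>
      |(L.accept τ z.1 z.2 : ℝ) - L.accept σ z.1 z.2| := fun τ =>
    ((BddMeasurable.accept (L.measurable_accept_right τ)).sub
      (BddMeasurable.accept (L.measurable_accept_right σ))).abs
  have h := tendsto_integral_filter_of_dominated_convergence (μ := L.pairLaw σ) (l := 𝓝 σ)
    (F := fun τ z => |(L.accept τ z.1 z.2 : ℝ) - L.accept σ z.1 z.2|) (f := fun _ => 0)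
    (fun _ => (1 + 1 : ℝ))
    (Eventually.of_forall fun τ => (hb τ).1.aestronglyMeasurable)
    (Eventually.of_forall fun τ => ae_of_all _ fun z => (hb τ).2 z)
    (integrable_const _) (ae_of_all _ fun z => ?_)
  · simpa using h
  · have hc : Continuous fun τ => |(L.accept τ z.1 z.2 : ℝ) - L.accept σ z.1 z.2| :=
      ((continuous_subtype_val.comp (hL.continuous_accept z.1 z.2)).sub continuous_const).abs
    have := hc.tendsto σ
    simpa using this

end LimitModel

/-! ### Local coordinates -/

section LocalCoord

variable {p : ℕ} {Θ : Set (EuclideanSpace ℝ (Fin p))}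

theorem localParam_localCoord {D : Matrix (Fin p) (Fin p) ℝ} (hD : IsUnit D.det) (θ₀ θ : Θ) :
    localParam D θ₀ (localCoord D θ₀ θ) = θ := by
  have h : (Matrix.toEuclideanCLM (𝕜 := ℝ) D⁻¹) * (Matrix.toEuclideanCLM (𝕜 := ℝ) D) = 1 := by
    rw [← map_mul, Matrix.nonsing_inv_mul _ hD, map_one]
  have h2 : Matrix.toEuclideanCLM (𝕜 := ℝ) D⁻¹ (Matrix.toEuclideanCLM (𝕜 := ℝ) D
      ((θ : EuclideanSpace ℝ (Fin p)) - θ₀)) = (θ : EuclideanSpace ℝ (Fin p)) - θ₀ :=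
    DFunLike.congr_fun h _
  rw [localParam, localCoord, h2, add_sub_cancel]

theorem localCoord_of_localParam_eq {D : Matrix (Fin p) (Fin p) ℝ} (hD : IsUnit D.det) (θ₀ θ : Θ)
    {u : EuclideanSpace ℝ (Fin p)} (hu : localParam D θ₀ u = θ) : localCoord D θ₀ θ = u := by
  have h : (Matrix.toEuclideanCLM (𝕜 := ℝ) D) * (Matrix.toEuclideanCLM (𝕜 := ℝ) D⁻¹) = 1 := by
    rw [← map_mul, Matrix.mul_nonsing_inv _ hD, map_one]
  have h2 : Matrix.toEuclideanCLM (𝕜 := ℝ) D (Matrix.toEuclideanCLM (𝕜 := ℝ) D⁻¹ u) = u :=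
    DFunLike.congr_fun h _
  rw [localCoord, ← hu, localParam, add_sub_cancel_left, h2]

open Classical in
/-- A measurable left inverse of `localCoord`. -/
noncomputable def localInv (D : Matrix (Fin p) (Fin p) ℝ) (θ₀ : Θ) (u : EuclideanSpace ℝ (Fin p)) :
    Θ :=
  ⟨if localParam D θ₀ u ∈ Θ then localParam D θ₀ u else θ₀, by
    split_ifs with h
    exacts [h, θ₀.2]⟩

theorem localInv_of_mem {D : Matrix (Fin p) (Fin p) ℝ} {θ₀ : Θ} {u : EuclideanSpace ℝ (Fin p)}
    (h : localParam D θ₀ u ∈ Θ) : localInv D θ₀ u = ⟨localParam D θ₀ u, h⟩ :=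
  Subtype.ext (if_pos h)

theorem measurable_localParam (D : Matrix (Fin p) (Fin p) ℝ) (θ₀ : Θ) :
    Measurable (localParam D θ₀) := by
  unfold localParam; fun_prop

theorem measurable_localInv (hΘ : MeasurableSet Θ) (D : Matrix (Fin p) (Fin p) ℝ) (θ₀ : Θ) :
    Measurable (localInv D θ₀) :=
  (Measurable.ite (measurable_localParam D θ₀ hΘ) (measurable_localParam D θ₀)
    measurable_const).subtype_mk

/-- The range is the preimage of `Θ` under the affine map `localParam`, and on it that map inverts
the coordinate. -/
theorem measurableEmbedding_localCoord (hΘ : MeasurableSet Θ) {D : Matrix (Fin p) (Fin p) ℝ}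
    (hD : IsUnit D.det) (θ₀ : Θ) : MeasurableEmbedding (localCoord D θ₀) := by
  have hl : Measurable (localCoord D θ₀) := by unfold localCoord; fun_prop
  have hr : Set.range (localCoord D θ₀) = localParam D θ₀ ⁻¹' Θ := by
    ext u
    constructor
    · rintro ⟨θ, rfl⟩
      rw [Set.mem_preimage, localParam_localCoord hD]
      exact θ.2
    · intro hu
      exact ⟨⟨_, hu⟩, localCoord_of_localParam_eq hD θ₀ _ rfl⟩
  refine MeasurableEmbedding.of_measurable_inverse hl (hr ▸ measurable_localParam D θ₀ hΘ)
    (measurable_localInv hΘ D θ₀) fun θ => ?_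
  have h : localParam D θ₀ (localCoord D θ₀ θ) ∈ Θ := by
    rw [localParam_localCoord hD]; exact θ.2
  rw [localInv_of_mem h]
  exact Subtype.ext (localParam_localCoord hD θ₀ θ)

end LocalCoord

theorem abs_integral_sub_le_tvDist {E : Type*} [MeasurableSpace E] (μ ν : Measure E)
    [IsProbabilityMeasure μ] [IsProbabilityMeasure ν] {F : E → ℝ} (hF : BddMeasurable 1 F) :
    |∫ x, F x ∂μ - ∫ x, F x ∂ν| ≤ tvDist μ ν := by
  -- A real supremum dominates its terms only when the family is bounded above; for probability
  -- measures `2` is a bound.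
  refine le_ciSup (f := fun f : {f : E → ℝ // Measurable f ∧ ∀ x, |f x| ≤ 1} =>
    |∫ x, f.1 x ∂μ - ∫ x, f.1 x ∂ν|) ⟨1 + 1, ?_⟩ ⟨F, hF⟩
  rintro _ ⟨f, rfl⟩
  exact (abs_sub _ _).trans (add_le_add (BddMeasurable.abs_integral_le (f := f.1) f.2)
    (BddMeasurable.abs_integral_le (f := f.1) f.2))

/-! ### Closeness to the limit model in probability -/

/-- Bounded variables that tend to zero in probability tend to zero in mean. -/
theorem TendstoZeroInProb.tendsto_lintegral {ι : Type*} {Ω : ι → Type*}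
    [∀ i, MeasurableSpace (Ω i)] {F : Filter ι} {μ : ∀ i, Measure (Ω i)}
    [∀ i, IsProbabilityMeasure (μ i)] {Y : ∀ i, Ω i → ℝ} (h : TendstoZeroInProb F μ Y)
    (hY : ∀ i, BddMeasurable 1 (Y i)) :
    Tendsto (fun i => ∫⁻ ω, ENNReal.ofReal |Y i ω| ∂μ i) F (𝓝 0) := by
  rw [ENNReal.tendsto_nhds_zero]
  intro ε hε
  obtain ⟨r, hr0, hrε⟩ := ENNReal.lt_iff_exists_nnreal_btwn.1 hε
  have hr : (0 : ℝ) < r := by exact_mod_cast hr0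
  have h1 := ENNReal.tendsto_nhds_zero.1 (h (r / 2) (by positivity)) (ENNReal.ofReal (r / 2))
    (ENNReal.ofReal_pos.2 (by positivity))
  filter_upwards [h1] with i hi
  have hm : MeasurableSet {ω | r / 2 ≤ |Y i ω|} := measurableSet_le measurable_const (hY i).1.abs
  calc ∫⁻ ω, ENNReal.ofReal |Y i ω| ∂μ i
      ≤ ∫⁻ ω, (ENNReal.ofReal (r / 2) + {ω | r / 2 ≤ |Y i ω|}.indicator 1 ω) ∂μ i := by
        refine lintegral_mono fun ω => ?_
        by_cases hω : r / 2 ≤ |Y i ω|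
        · rw [Set.indicator_of_mem (by exact hω)]
          exact (ENNReal.ofReal_le_one.2 ((hY i).2 ω)).trans le_add_self
        · exact (ENNReal.ofReal_le_ofReal (not_le.1 hω).le).trans le_self_add
    _ = ENNReal.ofReal (r / 2) + μ i {ω | r / 2 ≤ |Y i ω|} := by
        rw [lintegral_add_left measurable_const, lintegral_indicator_one hm]
        simp
    _ ≤ ENNReal.ofReal (r / 2) + ENNReal.ofReal (r / 2) := by gcongr
    _ = r := by
        rw [← ENNReal.ofReal_add (by positivity) (by positivity), add_halves,
          ENNReal.ofReal_coe_nnreal]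
    _ ≤ ε := hrε.le

section AcceptDiff

variable {𝒳 S : Type*} [MeasurableSpace 𝒳] [MeasurableSpace S] {p : ℕ}
  {Θ : Set (EuclideanSpace ℝ (Fin p))}

open Classical in
/-- The difference of the acceptance probabilities in local coordinates, read as `0` outside of
the parameter space. -/
@[irreducible]
noncomputable def acceptDiff (M : MetropolisHastings 𝒳 Θ) (L : LimitModel S p)
    (D : Matrix (Fin p) (Fin p) ℝ) (θ₀ : Θ) (x : 𝒳) (τ : S) (u v : EuclideanSpace ℝ (Fin p)) : ℝ :=
  if h : localParam D θ₀ u ∈ Θ ∧ localParam D θ₀ v ∈ Θ then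
    (M.accept x ⟨_, h.1⟩ ⟨_, h.2⟩ : ℝ) - (L.accept τ u v : ℝ)
  else 0

variable (M : MetropolisHastings 𝒳 Θ) (L : LimitModel S p) (D : Matrix (Fin p) (Fin p) ℝ) (θ₀ : Θ)

theorem abs_acceptDiff_le (x : 𝒳) (τ : S) (u v : EuclideanSpace ℝ (Fin p)) :
    |acceptDiff M L D θ₀ x τ u v| ≤ 1 := by
  unfold acceptDiff
  split_ifs with h
  · exact abs_sub_le_of_nonneg_of_le (M.accept _ _ _).2.1 (M.accept _ _ _).2.2
      (L.accept _ _ _).2.1 (L.accept _ _ _).2.2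
  · simp

/-- Where both points lie in `Θ` the sum is the acceptance probability of the algorithm, elsewhere
that of the limit. It therefore extends the former to all local coordinates while staying bounded by
`1`. -/
theorem abs_accept_add_acceptDiff_le (x : 𝒳) (τ : S) (u v : EuclideanSpace ℝ (Fin p)) :
    |(L.accept τ u v : ℝ) + acceptDiff M L D θ₀ x τ u v| ≤ 1 := by
  unfold acceptDiff
  split_ifs with h
  · rw [add_sub_cancel, abs_of_nonneg (M.accept _ _ _).2.1]
    exact (M.accept _ _ _).2.2
  · rw [add_zero, abs_of_nonneg (L.accept _ _ _).2.1]
    exact (L.accept _ _ _).2.2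

/-- Joint measurability in the data and the two points is what Fubini's theorem needs later; the
dependent condition is removed by means of the measurable inverse `localInv`. -/
theorem measurable_acceptDiff (hΘ : MeasurableSet Θ) {s : 𝒳 → S} (hs : Measurable s) :
    Measurable fun w : 𝒳 × EuclideanSpace ℝ (Fin p) × EuclideanSpace ℝ (Fin p) =>
      acceptDiff M L D θ₀ w.1 (s w.1) w.2.1 w.2.2 := by
  classical
  have e : (fun w : 𝒳 × EuclideanSpace ℝ (Fin p) × EuclideanSpace ℝ (Fin p) =>
      acceptDiff M L D θ₀ w.1 (s w.1) w.2.1 w.2.2) = fun w =>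
      if localParam D θ₀ w.2.1 ∈ Θ ∧ localParam D θ₀ w.2.2 ∈ Θ then
        (M.accept w.1 (localInv D θ₀ w.2.1) (localInv D θ₀ w.2.2) : ℝ) -
          (L.accept (s w.1) w.2.1 w.2.2 : ℝ) else 0 := by
    funext w
    unfold acceptDiff
    split_ifs with h
    · rw [localInv_of_mem h.1, localInv_of_mem h.2]
    · rfl
  rw [e]
  have hP := measurable_localParam D θ₀
  have hI := measurable_localInv hΘ D θ₀
  refine Measurable.ite ?_ (Measurable.sub ?_ ?_) measurable_const
  · exact (hP.comp (measurable_fst.comp measurable_snd) hΘ).inter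
      (hP.comp (measurable_snd.comp measurable_snd) hΘ)
  · exact measurable_subtype_coe.comp (M.measurable_accept.comp (by fun_prop : Measurable fun
      w : 𝒳 × EuclideanSpace ℝ (Fin p) × EuclideanSpace ℝ (Fin p) =>
        ((w.1, localInv D θ₀ w.2.1), localInv D θ₀ w.2.2)))
  · exact measurable_subtype_coe.comp (L.measurable_accept.comp (by fun_prop : Measurable fun
      w : 𝒳 × EuclideanSpace ℝ (Fin p) × EuclideanSpace ℝ (Fin p) => ((s w.1, w.2.1), w.2.2)))

theorem bddMeasurable_acceptDiff (hΘ : MeasurableSet Θ) (x : 𝒳) (τ : S) :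
    BddMeasurable 1 fun z : EuclideanSpace ℝ (Fin p) × EuclideanSpace ℝ (Fin p) =>
      acceptDiff M L D θ₀ x τ z.1 z.2 :=
  ⟨(measurable_acceptDiff M L D θ₀ hΘ (s := fun _ => τ) measurable_const).comp
    (measurable_prodMk_left (x := x)), fun _ => abs_acceptDiff_le M L D θ₀ x τ _ _⟩

variable {M L D θ₀}

/-- Triangle inequality with `τ` in the role of `s_N(x)`. The pair law is first replaced by the
limit law at `τ`, then by that at `σ`. With the acceptance weight, the weight is then also moved to
the limit weight at `τ` and from there to `σ`, both under the law at `σ`. -/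
theorem isClose_of_acceptDiff (hΘ : MeasurableSet Θ) (hD : IsUnit D.det) (x : 𝒳) (σ τ : S) :
    M.IsClose x L σ (localCoord D θ₀)
      (tvDist ((M.target x ⊗ₘ M.proposal.sectR x).map
          (Prod.map (localCoord D θ₀) (localCoord D θ₀))) (L.target τ ⊗ₘ L.proposal.sectR τ) +
        ∫ z, |(L.pairDensity τ z : ℝ) - L.pairDensity σ z| ∂(volume.prod volume) +
        ∫ z, |(L.accept τ z.1 z.2 : ℝ) - L.accept σ z.1 z.2| ∂(L.pairLaw σ) +
        ∫ z, |acceptDiff M L D θ₀ x τ z.1 z.2| ∂(L.pairLaw σ)) := by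
  have hl := (measurableEmbedding_localCoord hΘ hD θ₀).measurable
  set l := localCoord D θ₀ with hldef
  have hll : Measurable (Prod.map l l) := hl.prodMap hl
  set Γ := M.target x ⊗ₘ M.proposal.sectR x
  have : IsProbabilityMeasure (Γ.map (Prod.map l l)) :=
    Measure.isProbabilityMeasure_map hll.aemeasurable
  have htv : ∀ F : EuclideanSpace ℝ (Fin p) × EuclideanSpace ℝ (Fin p) → ℝ, BddMeasurable 1 F →
      |∫ z, F (Prod.map l l z) ∂Γ - ∫ z, F z ∂(L.pairLaw τ)| ≤
        tvDist (Γ.map (Prod.map l l)) (L.pairLaw τ) := by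
    intro F hF
    rw [← integral_map (f := F) hll.aemeasurable hF.1.aestronglyMeasurable]
    exact abs_integral_sub_le_tvDist _ _ hF
  have hV : 0 ≤ ∫ z, |(L.accept τ z.1 z.2 : ℝ) - L.accept σ z.1 z.2| ∂(L.pairLaw σ) :=
    integral_nonneg fun _ => abs_nonneg _
  have hJ : 0 ≤ ∫ z, |acceptDiff M L D θ₀ x τ z.1 z.2| ∂(L.pairLaw σ) :=
    integral_nonneg fun _ => abs_nonneg _
  refine ⟨fun F hF => ?_, fun F hF => ?_⟩
  · refine (abs_sub_le _ (∫ z, F z ∂(L.pairLaw τ)) _).trans ?_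
    have h1 := htv F hF
    have h2 := L.abs_integral_pairLaw_sub_le τ σ hF
    unfold LimitModel.pairLaw at *
    linarith
  · set A : EuclideanSpace ℝ (Fin p) × EuclideanSpace ℝ (Fin p) → ℝ := fun z =>
      (L.accept τ z.1 z.2 : ℝ) + acceptDiff M L D θ₀ x τ z.1 z.2 with hA
    have hτ := BddMeasurable.accept (L.measurable_accept_right τ)
    have hσ := BddMeasurable.accept (L.measurable_accept_right σ)
    have hd := bddMeasurable_acceptDiff M L D θ₀ hΘ x τ
    have hAb : BddMeasurable 1 A :=
      ⟨hτ.1.add hd.1, fun z => abs_accept_add_acceptDiff_le M L D θ₀ x τ _ _⟩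
    have hAF : BddMeasurable 1 fun z => A z * F z := by
      have := hAb.mul hF; rwa [one_mul] at this
    -- On the image of `Θ × Θ` the extended weight `A` is the acceptance probability of the
    -- algorithm, so the total variation bound may be applied to the single function `A F`.
    have hAeq : ∀ z : Θ × Θ, (M.accept x z.1 z.2 : ℝ) * F (Prod.map l l z) =
        A (Prod.map l l z) * F (Prod.map l l z) := by
      intro z
      congr 1
      have hz : ∀ θ : Θ, localParam D θ₀ (localCoord D θ₀ θ) ∈ Θ := fun θ => by
        rw [localParam_localCoord hD]; exact θ.2
      have hz' : ∀ θ : Θ, (⟨_, hz θ⟩ : Θ) = θ := fun θ =>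
        Subtype.ext (localParam_localCoord hD θ₀ θ)
      simp only [hA, acceptDiff, Prod.map_fst, Prod.map_snd, hldef]
      rw [dif_pos ⟨hz z.1, hz z.2⟩, add_sub_cancel]
      simp only [hz']
    simp_rw [hAeq]
    have h1 := htv _ hAF
    have h2 := L.abs_integral_pairLaw_sub_le τ σ hAF
    have h3 : |∫ z, A z * F z ∂(L.pairLaw σ) - ∫ z, L.accept σ z.1 z.2 * F z ∂(L.pairLaw σ)| ≤
        ∫ z, |(L.accept τ z.1 z.2 : ℝ) - L.accept σ z.1 z.2| ∂(L.pairLaw σ) +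
          ∫ z, |acceptDiff M L D θ₀ x τ z.1 z.2| ∂(L.pairLaw σ) := by
      have i1 : Integrable (fun z : EuclideanSpace ℝ (Fin p) × EuclideanSpace ℝ (Fin p) =>
          |(L.accept τ z.1 z.2 : ℝ) - L.accept σ z.1 z.2|) (L.pairLaw σ) :=
        (hτ.sub hσ).abs.integrable _
      have i2 := hd.abs.integrable (L.pairLaw σ)
      rw [← integral_sub (hAF.integrable _) ((hσ.mul hF).integrable _), ← integral_add i1 i2]
      refine abs_integral_le_integral_abs.trans (integral_mono
        ((hAF.integrable _).sub ((hσ.mul hF).integrable _)).abs (i1.add i2) fun z => ?_)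
      simp only
      rw [← sub_mul, abs_mul]
      refine (mul_le_of_le_one_right (abs_nonneg _) (hF.2 z)).trans ?_
      have e : A z - L.accept σ z.1 z.2 = ((L.accept τ z.1 z.2 : ℝ) - L.accept σ z.1 z.2) +
          acceptDiff M L D θ₀ x τ z.1 z.2 := by simp only [hA]; ring
      rw [e]
      exact abs_add_le _ _
    have h4 := abs_sub_le (∫ z, A (Prod.map l l z) * F (Prod.map l l z) ∂Γ)
      (∫ z, A z * F z ∂(L.pairLaw τ)) (∫ z, L.accept σ z.1 z.2 * F z ∂(L.pairLaw σ))
    have h5 := abs_sub_le (∫ z, A z * F z ∂(L.pairLaw τ)) (∫ z, A z * F z ∂(L.pairLaw σ))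
      (∫ z, L.accept σ z.1 z.2 * F z ∂(L.pairLaw σ))
    unfold LimitModel.pairLaw at *
    linarith

end AcceptDiff

/-- Pointwise convergence in probability of the acceptance probabilities implies convergence in
mean with respect to the limit law of the state and the proposal. -/
theorem tendsto_measure_le_integral_acceptDiff {p : ℕ} {S : Type*} [MeasurableSpace S]
    {Θ : Set (EuclideanSpace ℝ (Fin p))} (hΘ : MeasurableSet Θ) {𝒳 : ℕ → Type*}
    [∀ N, MeasurableSpace (𝒳 N)] (P : ∀ N, Measure (𝒳 N)) [∀ N, IsProbabilityMeasure (P N)]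
    (θ₀ : Θ) (D : ℕ → Matrix (Fin p) (Fin p) ℝ) (M : ∀ N, MetropolisHastings (𝒳 N) Θ)
    (L : LimitModel S p) {s : ∀ N, 𝒳 N → S} (hs : ∀ N, Measurable (s N))
    (h_accept : ∀ u v : EuclideanSpace ℝ (Fin p), TendstoZeroInProb atTop P
      fun N x => acceptDiff (M N) L (D N) θ₀ x (s N x) u v)
    (σ : S) {ε : ℝ} (hε : 0 < ε) :
    Tendsto (fun N => P N {x | ε ≤ ∫ z, |acceptDiff (M N) L (D N) θ₀ x (s N x) z.1 z.2|
      ∂(L.pairLaw σ)}) atTop (𝓝 0) := by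
  have hmeas := fun N => (measurable_acceptDiff (M N) L (D N) θ₀ hΘ (hs N)).abs.ennreal_ofReal
  -- The law at `σ` does not depend on `x`, so the order of integration can be exchanged; for fixed
  -- `u, v` the inner mean then tends to zero by hypothesis. Markov's inequality returns to
  -- probabilities.
  have hswap : ∀ N, ∫⁻ x, ∫⁻ z, ENNReal.ofReal |acceptDiff (M N) L (D N) θ₀ x (s N x) z.1 z.2|
      ∂(L.pairLaw σ) ∂(P N) = ∫⁻ z, ∫⁻ x,
        ENNReal.ofReal |acceptDiff (M N) L (D N) θ₀ x (s N x) z.1 z.2| ∂(P N) ∂(L.pairLaw σ) :=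
    fun N => lintegral_lintegral_swap (hmeas N).aemeasurable
  have hlim : Tendsto (fun N => ∫⁻ z, ∫⁻ x,
      ENNReal.ofReal |acceptDiff (M N) L (D N) θ₀ x (s N x) z.1 z.2| ∂(P N) ∂(L.pairLaw σ))
      atTop (𝓝 (∫⁻ _, 0 ∂(L.pairLaw σ))) := by
    refine tendsto_lintegral_filter_of_dominated_convergence (fun _ => 1)
      (Eventually.of_forall fun N => (hmeas N).lintegral_prod_left')
      (Eventually.of_forall fun N => ae_of_all _ fun z => ?_) (by simp) (ae_of_all _ fun z => ?_)
    · calc _ ≤ ∫⁻ _, 1 ∂(P N) := lintegral_mono fun x =>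
            ENNReal.ofReal_le_one.2 (abs_acceptDiff_le _ _ _ _ _ _ _ _)
        _ = 1 := by simp
    · exact (h_accept z.1 z.2).tendsto_lintegral fun N =>
        ⟨(measurable_acceptDiff (M N) L (D N) θ₀ hΘ (hs N)).comp
          (measurable_prodMk_right (y := z)), fun x => abs_acceptDiff_le _ _ _ _ _ _ _ _⟩
  have hdiv := ENNReal.Tendsto.div_const hlim (b := ENNReal.ofReal ε)
    (Or.inr (ENNReal.ofReal_pos.2 hε).ne')
  rw [lintegral_zero, ENNReal.zero_div] at hdiv
  refine tendsto_of_tendsto_of_tendsto_of_le_of_le tendsto_const_nhds hdiv (fun _ => zero_le)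
    fun N => ?_
  simp only
  rw [← hswap N]
  refine le_trans (measure_mono fun x hx => ?_) (meas_ge_le_lintegral_div
    (hmeas N).lintegral_prod_right'.aemeasurable (ENNReal.ofReal_pos.2 hε).ne'
    ENNReal.ofReal_ne_top)
  have hd := (bddMeasurable_acceptDiff (M N) L (D N) θ₀ hΘ x (s N x)).abs.integrable (L.pairLaw σ)
  change ENNReal.ofReal ε ≤ ∫⁻ z, ENNReal.ofReal |acceptDiff (M N) L (D N) θ₀ x (s N x) z.1 z.2|
    ∂(L.pairLaw σ)
  rw [← ofReal_integral_eq_lintegral_ofReal hd (ae_of_all _ fun _ => abs_nonneg _)]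
  exact ENNReal.ofReal_le_ofReal hx

/-! ### Local consistency -/

section Consistency

universe u

variable {p : ℕ} {S : Type*} {Θ : Set (EuclideanSpace ℝ (Fin p))} {𝒳 : ℕ → Type u} [∀ N, MeasurableSpace (𝒳 N)]
  (P : ∀ N, Measure (𝒳 N)) (θ₀ : Θ) (D : ℕ → Matrix (Fin p) (Fin p) ℝ)
  (M : ∀ N, MetropolisHastings (𝒳 N) Θ) (s : ∀ N, 𝒳 N → S)
  (C : ℕ → Set (EuclideanSpace ℝ (Fin p)))

/-- Over the event `s_N ∈ K`, and off events of vanishing probability, the mean error is at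
most `η` for long chains. -/
def SmallMeanErrorOn (η : ℝ) (K : Set S) : Prop :=
  ∃ bad : ∀ N, Set (𝒳 N), Tendsto (fun N => P N (bad N)) atTop (𝓝 0) ∧ ∃ m₀ : ℕ,
    ∀ N, ∀ m ≥ m₀, ∀ x ∉ bad N, s N x ∈ K →
      ∫⁻ θ, partitionDist C (((M N).target x).map (localCoord (D N) θ₀))
        ((empiricalDist m θ).map (localCoord (D N) θ₀)) ∂((M N).chain x) ≤ ENNReal.ofReal η

variable {P θ₀ D M s C}

theorem SmallMeanErrorOn.union {η : ℝ} {K K' : Set S} (h : SmallMeanErrorOn P θ₀ D M s C η K)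
    (h' : SmallMeanErrorOn P θ₀ D M s C η K') : SmallMeanErrorOn P θ₀ D M s C η (K ∪ K') := by
  obtain ⟨b, hb, m, hm⟩ := h
  obtain ⟨b', hb', m', hm'⟩ := h'
  refine ⟨fun N => b N ∪ b' N, ?_, max m m', fun N n hn x hx hxK => ?_⟩
  · have := hb.add hb'
    rw [add_zero] at this
    exact tendsto_of_tendsto_of_tendsto_of_le_of_le tendsto_const_nhds this (fun _ => zero_le)
      fun N => measure_union_le _ _
  · rcases hxK with hK | hK
    · exact hm N n (le_of_max_le_left hn) x (fun h => hx (Or.inl h)) hK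
    · exact hm' N n (le_of_max_le_right hn) x (fun h => hx (Or.inr h)) hK

variable [MeasurableSpace S] [TopologicalSpace S]

/-- Four terms bound the distance to the limit at `σ`, each allowed `a / 4`. The two that compare
`s_N` with `σ` are small on a neighbourhood of `σ`, by continuity; the other two are small off the
bad events, whose probability vanishes. -/
theorem exists_mem_nhds_smallMeanErrorOn [FirstCountableTopology S]
    [∀ N, IsProbabilityMeasure (P N)] (hΘ : MeasurableSet Θ) (hD : ∀ N, IsUnit (D N).det)
    {L : LimitModel S p} (hs : ∀ N, Measurable (s N)) (h_regular : L.IsRegular)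
    (h_accept : ∀ u v : EuclideanSpace ℝ (Fin p), TendstoZeroInProb atTop P
      fun N x => acceptDiff (M N) L (D N) θ₀ x (s N x) u v)
    (h_tv : TendstoZeroInProb atTop P fun N x => tvDist
      (((M N).target x ⊗ₘ (M N).proposal.sectR x).map
        (Prod.map (localCoord (D N) θ₀) (localCoord (D N) θ₀)))
      (L.target (s N x) ⊗ₘ L.proposal.sectR (s N x)))
    {σ : S} (hσ : IsErgodicKernel (L.kernel.sectR σ) (L.target σ))
    (hCm : ∀ i, MeasurableSet (C i)) (hCd : Pairwise (Function.onFun Disjoint C)) {η : ℝ}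
    (hη : 0 < η) : ∃ U ∈ 𝓝 σ, SmallMeanErrorOn P θ₀ D M s C η U := by
  obtain ⟨a, ha, m₀, hm₀⟩ := exists_forall_lintegral_partitionDist_le.{u} (T := Θ) L σ hσ hCm hCd hη
  have ha4 : 0 < a / 4 := by positivity
  have hU := ((L.tendsto_integral_abs_pairDensity_sub h_regular σ).eventually_le_const ha4).and
    ((L.tendsto_integral_abs_accept_sub h_regular σ).eventually_le_const ha4)
  refine ⟨_, hU, fun N => {x | a / 4 ≤ |tvDist
      (((M N).target x ⊗ₘ (M N).proposal.sectR x).map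
        (Prod.map (localCoord (D N) θ₀) (localCoord (D N) θ₀)))
      (L.target (s N x) ⊗ₘ L.proposal.sectR (s N x))|} ∪
      {x | a / 4 ≤ ∫ z, |acceptDiff (M N) L (D N) θ₀ x (s N x) z.1 z.2| ∂(L.pairLaw σ)},
    ?_, m₀, ?_⟩
  · have := (h_tv _ ha4).add
      (tendsto_measure_le_integral_acceptDiff hΘ P θ₀ D M L hs h_accept σ ha4)
    rw [add_zero] at this
    exact tendsto_of_tendsto_of_tendsto_of_le_of_le tendsto_const_nhds this (fun _ => zero_le)
      fun N => measure_union_le _ _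
  · intro N m hm x hx hxU
    simp only [Set.mem_union, Set.mem_ofPred_eq, not_or, not_le] at hx
    obtain ⟨h1, h2⟩ := hx
    have hclose := isClose_of_acceptDiff (M := M N) (L := L) (θ₀ := θ₀) hΘ (hD N) x σ (s N x)
    have hle : ∀ {b : ℝ}, (M N).IsClose x L σ (localCoord (D N) θ₀) b → b ≤ a →
        (M N).IsClose x L σ (localCoord (D N) θ₀) a := fun h hb =>
      ⟨fun F hF => (h.1 F hF).trans hb, fun F hF => (h.2 F hF).trans hb⟩
    refine hm₀ (𝒳 N) (M N) x _ (measurableEmbedding_localCoord hΘ (hD N) θ₀) (hle hclose ?_) m hm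
    have h3 := hxU.1
    have h4 := hxU.2
    have h5 := (le_abs_self _).trans h1.le
    linarith

/-- Markov's inequality under the joint law is applied to this countable sum, so measurability of
`blDist`, a supremum over an uncountable family, is never required. -/
theorem measurable_partitionDist {𝒳 : Type*} [MeasurableSpace 𝒳] {T E : Type*} [MeasurableSpace T]
    [MeasurableSpace E] (κ : Kernel 𝒳 T) [IsMarkovKernel κ] {l : T → E} (hl : Measurable l)
    {C : ℕ → Set E} (hC : ∀ i, MeasurableSet (C i)) (m : ℕ) :
    Measurable fun z : 𝒳 × (ℕ → T) =>
      partitionDist C ((κ z.1).map l) ((empiricalDist m z.2).map l) := by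
  refine Measurable.tsum fun i => Measurable.ennreal_ofReal (Measurable.abs (Measurable.sub ?_ ?_))
  · simp_rw [measureReal_def, Measure.map_apply hl (hC i)]
    exact ((κ.measurable_coe (hl (hC i))).comp measurable_fst).ennreal_toReal
  · simp_rw [measureReal_map_empiricalDist hl m _ (hC i)]
    refine measurable_const.mul (Finset.measurable_fun_sum _ fun j _ => ?_)
    exact ((measurable_const.indicator (hC i)).comp hl).comp
      ((measurable_pi_apply j).comp measurable_snd)

theorem measure_ge_ofReal_le {α : Type*} [MeasurableSpace α] {ν : Measure α} {f : α → ℝ≥0∞}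
    (hf : Measurable f) {a b : ℝ} (ha : 0 < a) (h : ∫⁻ x, f x ∂ν ≤ ENNReal.ofReal (a * b)) :
    ν {x | ENNReal.ofReal a ≤ f x} ≤ ENNReal.ofReal b := by
  refine (meas_ge_le_lintegral_div hf.aemeasurable (ENNReal.ofReal_pos.2 ha).ne'
    ENNReal.ofReal_ne_top).trans ?_
  rw [ENNReal.div_le_iff (ENNReal.ofReal_pos.2 ha).ne' ENNReal.ofReal_ne_top, mul_comm,
    ← ENNReal.ofReal_mul ha.le]
  exact h

attribute [irreducible] partitionDist

/-- The probability `r` is split into three parts: the bad event, `s_N ∉ K` by tightness, and, for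
the remaining data, a large error of the chain given the data, by Markov's inequality. -/
theorem locallyConsistent_of_smallMeanErrorOn [∀ N, IsProbabilityMeasure (P N)]
    (hΘ : MeasurableSet Θ) (hD : ∀ N, IsUnit (D N).det) (hs : ∀ N, Measurable (s N))
    (h_tight : IsTightMeasureSet (Set.range fun N => (P N).map (s N)))
    (h : ∀ C : ℕ → Set (EuclideanSpace ℝ (Fin p)), (∀ i, MeasurableSet (C i)) →
      Pairwise (Function.onFun Disjoint C) → ∀ η : ℝ, 0 < η → ∀ K : Set S, IsCompact K →
        SmallMeanErrorOn P θ₀ D M s C η K) :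
    LocallyConsistent P D θ₀ M := by
  intro ε hε
  rw [ENNReal.tendsto_nhds_zero]
  intro δ hδ
  obtain ⟨r, hr0, hrδ⟩ := ENNReal.lt_iff_exists_nnreal_btwn.1 hδ
  have hr : (0 : ℝ) < r := by exact_mod_cast hr0
  have hr3 : (0 : ℝ) < r / 3 := by positivity
  -- Cells of radius `ε / 4` use up `ε / 2` of the distance. The other `ε / 2` is the level in
  -- Markov's inequality, whence the mean error `ε / 2 * (r / 3)` below.
  obtain ⟨C, hCm, hCd, hCu, hCε⟩ := exists_partition (E := EuclideanSpace ℝ (Fin p))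
    (by positivity : 0 < ε / 4)
  obtain ⟨K, hK, hKP⟩ := isTightMeasureSet_iff_exists_isCompact_measure_compl_le.1 h_tight
    (ENNReal.ofReal (r / 3)) (ENNReal.ofReal_pos.2 hr3)
  obtain ⟨bad, hbad, m₀, hm₀⟩ := h C hCm hCd (ε / 2 * (r / 3)) (by positivity) K hK
  have hev1 : ∀ᶠ N in atTop, P N (bad N) ≤ ENNReal.ofReal (r / 3) :=
    ENNReal.tendsto_nhds_zero.1 hbad _ (ENNReal.ofReal_pos.2 hr3)
  -- The `1` in the maximum ensures `m > 0`, without which the empirical distribution is not a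
  -- probability measure.
  filter_upwards [hev1.prod_mk (eventually_ge_atTop (max m₀ 1))] with k ⟨hk1, hk2⟩
  obtain ⟨N, m⟩ := k
  simp only at hk1 hk2
  have hm0 : 0 < m := lt_of_lt_of_le Nat.one_pos (le_of_max_le_right hk2)
  have hl := (measurableEmbedding_localCoord hΘ (hD N) θ₀).measurable
  set l := localCoord (D N) θ₀
  set H : Set (𝒳 N × (ℕ → Θ)) := {z | ENNReal.ofReal (ε / 2) ≤
    partitionDist C (((M N).target z.1).map l) ((empiricalDist m z.2).map l)}
  have hpm := measurable_partitionDist (M N).target hl hCm m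
  have hH : MeasurableSet H := measurableSet_le measurable_const hpm
  have hsub : {z : 𝒳 N × (ℕ → Θ) | ε ≤ |blDist (((M N).target z.1).map l)
      ((empiricalDist m z.2).map l)|} ⊆ H := by
    intro z hz
    have := isProbabilityMeasure_empiricalDist hm0 z.2
    have : IsProbabilityMeasure ((empiricalDist m z.2).map l) :=
      Measure.isProbabilityMeasure_map hl.aemeasurable
    have : IsProbabilityMeasure (((M N).target z.1).map l) :=
      Measure.isProbabilityMeasure_map hl.aemeasurable
    have h1 := ofReal_blDist_le hCm hCd hCu hCε (((M N).target z.1).map l)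
      ((empiricalDist m z.2).map l)
    have hz' : ε ≤ |blDist (((M N).target z.1).map l) ((empiricalDist m z.2).map l)| := hz
    rw [abs_of_nonneg (blDist_nonneg _ _)] at hz'
    have h2 := (ENNReal.ofReal_le_ofReal hz').trans h1
    rw [show ε = 2 * (ε / 4) + ε / 2 by ring, ENNReal.ofReal_add (by positivity) (by positivity),
      show 2 * (ε / 4) + ε / 2 = ε by ring] at h2
    exact (ENNReal.add_le_add_iff_left ENNReal.ofReal_ne_top).1 h2
  -- The bad sets are not assumed measurable, so a measurable hull of the same measure is used.
  set B : Set (𝒳 N) := toMeasurable (P N) (bad N ∪ {x | s N x ∉ K})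
  have hB : P N B ≤ ENNReal.ofReal (r / 3) + ENNReal.ofReal (r / 3) := by
    rw [measure_toMeasurable]
    refine (measure_union_le _ _).trans (add_le_add hk1 ?_)
    exact (Measure.le_map_apply (hs N).aemeasurable Kᶜ).trans (hKP _ ⟨N, rfl⟩)
  refine (measure_mono hsub).trans (le_trans ?_ hrδ.le)
  rw [Measure.compProd_apply hH]
  calc ∫⁻ x, (M N).chain x (Prod.mk x ⁻¹' H) ∂(P N)
      ≤ ∫⁻ x, (B.indicator 1 x + ENNReal.ofReal (r / 3)) ∂(P N) := by
        refine lintegral_mono fun x => ?_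
        by_cases hx : x ∈ B
        · rw [Set.indicator_of_mem hx]
          exact prob_le_one.trans le_self_add
        · have hx' : x ∉ bad N ∪ {x | s N x ∉ K} := fun h => hx (subset_toMeasurable _ _ h)
          rw [Set.mem_union, not_or] at hx'
          refine le_trans ?_ le_add_self
          exact measure_ge_ofReal_le (hpm.comp (measurable_prodMk_left (x := x))) (half_pos hε)
            (hm₀ N m (le_of_max_le_left hk2) x hx'.1 (not_not.1 hx'.2))
    _ = P N B + ENNReal.ofReal (r / 3) := by
        rw [lintegral_add_right _ measurable_const,
          lintegral_indicator_one (measurableSet_toMeasurable _ _), lintegral_const, measure_univ,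
          mul_one]
    _ ≤ ENNReal.ofReal (r / 3) + ENNReal.ofReal (r / 3) + ENNReal.ofReal (r / 3) := by gcongr
    _ = r := by
        rw [← ENNReal.ofReal_add hr3.le hr3.le, ← ENNReal.ofReal_add (by positivity) hr3.le,
          ← ENNReal.ofReal_coe_nnreal]
        congr 1
        ring

end Consistency

open Classical in
theorem mainTheorem2
    {p q : ℕ} {Θ : Set (EuclideanSpace ℝ (Fin p))} (hΘ : IsOpen Θ)
    {S : Set (EuclideanSpace ℝ (Fin q))} (hS : IsOpen S)
    -- the experiments, the true parameter and the norming matrices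
    {𝒳 : ℕ → Type*} [∀ N, MeasurableSpace (𝒳 N)]
    (P : ∀ N, Θ → Measure (𝒳 N)) [∀ N θ, IsProbabilityMeasure (P N θ)] (θ₀ : Θ)
    (D : ℕ → Matrix (Fin p) (Fin p) ℝ) (hD : ∀ N, IsUnit (D N).det)
    -- the algorithms, the limit model and the statistics `s_N`
    (M : ∀ N, MetropolisHastings (𝒳 N) Θ) (L : LimitModel S p)
    (s : ∀ N, 𝒳 N → S) (hs : ∀ N, Measurable (s N))
    (h_ergodic : ∀ σ : S, IsErgodicKernel (L.kernel.sectR σ) (L.target σ))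
    (h_tight : IsTightMeasureSet (Set.range fun N => (P N θ₀).map (s N)))
    (h_regular : L.IsRegular)
    -- `A_N(θ₀ + D_N⁻¹ u, θ₀ + D_N⁻¹ v | x) - A(u, v | s_N) → 0` in probability for all `u, v`;
    -- nothing is asked for those `N` for which one of the two points is outside `Θ`
    (h_accept : ∀ u v : EuclideanSpace ℝ (Fin p),
      TendstoZeroInProb atTop (fun N => P N θ₀) fun N x =>
        if h : localParam (D N) θ₀ u ∈ Θ ∧ localParam (D N) θ₀ v ∈ Θ then
          ((M N).accept x ⟨_, h.1⟩ ⟨_, h.2⟩ : ℝ) - (L.accept (s N x) u v : ℝ)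
        else 0)
    (h_tv : TendstoZeroInProb atTop (fun N => P N θ₀) fun N x =>
      tvDist
        (((M N).target x ⊗ₘ (M N).proposal.sectR x).map
          (Prod.map (localCoord (D N) θ₀) (localCoord (D N) θ₀)))
        (L.target (s N x) ⊗ₘ L.proposal.sectR (s N x))) :
    LocallyConsistent (fun N => P N θ₀) D θ₀ M := by
  have h_accept' : ∀ u v, TendstoZeroInProb atTop (fun N => P N θ₀) fun N x =>
      acceptDiff (M N) L (D N) θ₀ x (s N x) u v := by
    unfold acceptDiff
    exact h_accept
  refine locallyConsistent_of_smallMeanErrorOn hΘ.measurableSet hD hs h_tight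
    fun C hCm hCd η hη K hK => ?_
  -- Compactness: the property holds for the empty set, passes to subsets and to unions of two sets,
  -- and holds near each point.
  refine hK.induction_on (p := SmallMeanErrorOn (fun N => P N θ₀) θ₀ D M s C η)
    ⟨fun _ => ∅, by simp, 0, fun N m _ x _ hx => hx.elim⟩
    (fun K K' hKK ⟨bad, hbad, m₀, hm₀⟩ =>
      ⟨bad, hbad, m₀, fun N m hm x hx hxK => hm₀ N m hm x hx (hKK hxK)⟩)
    (fun K K' h h' => h.union h') fun σ _ => ?_
  obtain ⟨U, hU, hUs⟩ := exists_mem_nhds_smallMeanErrorOn hΘ.measurableSet hD hs h_regular h_accept'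
    h_tv (h_ergodic σ) hCm hCd hη
  exact ⟨U, mem_nhdsWithin_of_mem_nhds hU, hUs⟩
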